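/- Let $\mathbb T=\mathbb R/\mathbb Z$ with Lebesgue measure $\lambda_{\mathbb T}$, let $\alpha\in\mathbb R$ be irrational and $Tx=x+\alpha$ on $\mathbb T$. Let $f:\mathbb T\to(0,\infty)$ be a left-continuous function of bounded variation, and write $d(y)=f(y^+)-f(y^-)$ for its jump at $y\in\mathbb T$ (identified with $[0,1)$; at $y=0$ the jump is $f(0^+)-f(1^-)$). Suppose that $f$ has no singular continuous part, i.e. that there is an absolutely continuous function $f_a$ on $[0,1]$ with $$f(x)=f_a(x)+\sum_{0\le y<x}d(y)\qquad(0\le x\le 1,\ \text{where } f(1):=f(0)),$$ and that the (absolutely convergent) sum of jumps $S(f)=\sum_{0\le y<1}d(y)$ is nonzero. For $m\in\mathbb Z$ put $f^{(m)}(x)=\sum_{k=0}^{m-1}f(T^kx)$ if $m\ge 0$ and $f^{(m)}(x)=-\sum_{k=m}^{-1}f(T^kx)$ if $m<0$. Then for all $x\in\mathbb T$ and $r\in\mathbb R$ there is a unique $n\in\mathbb Z$ with $f^{(n)}(x)\le r<f^{(n+1)}(x)$, so that the special flow over $T$ under $f$, $$T^f_t(x,s)=\bigl(T^nx,\;s+t-f^{(n)}(x)\bigr),\qquad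 f^{(n)}(x)\le s+t<f^{(n+1)}(x),$$ is defined on $\mathbb T^f=\{(x,s)\in\mathbb T\times\mathbb R:0\le s<f(x)\}$. With respect to the probability measure $\mu$ obtained by restricting $\lambda_{\mathbb T}\times\lambda_{\mathbb R}$ to $\mathbb T^f$ and dividing by its total mass $\int_{\mathbb T}f\,d\lambda_{\mathbb T}$, the family $(T^f_t)_{t\in\mathbb R}$ is a jointly measurable, measure-preserving, ergodic flow, and it is weakly mixing: for all measurable $A,B\subseteq\mathbb T^f$, $$\lim_{\tau\to+\infty}\frac1\tau\int_0^\tau\bigl|\mu(T^f_tA\cap B)-\mu(A)\mu(B)\bigr|\,dt=0.$$ -/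

import Mathlib

open MeasureTheory Filter Topology Set

noncomputable section

namespace SpecialFlow

/-! ### Functions on the circle -/

/-- The `1`-periodic function on `ℝ` corresponding to a function on `𝕋 = ℝ / ℤ`. -/
def lift (f : UnitAddCircle → ℝ) : ℝ → ℝ := fun x => f (x : UnitAddCircle)

/-- Bounded variation on `𝕋`: the variation along one turn `[0, 1]` of the circle is finite. -/
def IsBV (f : UnitAddCircle → ℝ) : Prop := BoundedVariationOn (lift f) (Icc 0 1)

/-- Left-continuity at every point of `𝕋`. -/
def IsLeftContinuous (f : UnitAddCircle → ℝ) : Prop :=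
  ∀ x : ℝ, ContinuousWithinAt (lift f) (Iic x) x

/-- The jump `f(y⁺) - f(y⁻)` at (the class of) `y`; for `f` of bounded variation both one-sided
limits exist. By periodicity the jump at `0` is `f(0⁺) - f(1⁻)`. -/
def jump (f : UnitAddCircle → ℝ) (y : ℝ) : ℝ :=
  Function.rightLim (lift f) y - Function.leftLim (lift f) y

/-- The jump part of the Lebesgue decomposition on `[0, 1]`:
`f_j(x) = ∑_{0 ≤ y < x} (f(y⁺) - f(y⁻))`. The series converges absolutely if `f` has bounded
variation. -/
def jumpPart (f : UnitAddCircle → ℝ) (x : ℝ) : ℝ := ∑' y : Ico (0 : ℝ) x, jump f y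

/-- The sum of all jumps of `f` over the circle. The series converges absolutely if `f` has bounded
variation. -/
def jumpSum (f : UnitAddCircle → ℝ) : ℝ := ∑' y : Ico (0 : ℝ) 1, jump f y

/-- The class `BV_{a+j}`: left-continuous functions of bounded variation on `𝕋` whose Lebesgue
decomposition `f = f_a + f_j + f_s` on `[0, 1]` has no singular continuous part `f_s`. -/
structure IsBVaj (f : UnitAddCircle → ℝ) : Prop where
  bv : IsBV f
  leftContinuous : IsLeftContinuous f
  decomposition : ∃ fa : ℝ → ℝ, AbsolutelyContinuousOnInterval fa 0 1 ∧
    ∀ x ∈ Icc (0 : ℝ) 1, lift f x = fa x + jumpPart f x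

/-- The rotation `x ↦ x + α` of the circle. -/
def rotation (α : ℝ) : Equiv.Perm UnitAddCircle := Equiv.addRight (α : UnitAddCircle)

/-! ### Special flows -/

section Special

variable {X : Type*}

/-- The cocycle `f^{(m)}` over an invertible map `T`: it is `f(x) + ⋯ + f(T^{m-1}x)` for `m > 0`,
`0` for `m = 0` and `-(f(T^m x) + ⋯ + f(T^{-1}x))` for `m < 0` (at most one of the two sums below
is nonempty). -/
def cocycle (T : Equiv.Perm X) (f : X → ℝ) (m : ℤ) (x : X) : ℝ :=
  ∑ k ∈ Finset.Ico 0 m, f ((T ^ k) x) - ∑ k ∈ Finset.Ico m 0, f ((T ^ k) x)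

theorem cocycle_succ (T : Equiv.Perm X) (f : X → ℝ) (m : ℤ) (x : X) :
    cocycle T f (m + 1) x = cocycle T f m x + f ((T ^ m) x) := by
  unfold cocycle
  rcases le_or_gt 0 m with h | h
  · rw [Finset.Ico_eq_empty (a := m + 1) (b := 0) (by omega),
      Finset.Ico_eq_empty (a := m) (b := 0) (by omega),
      ← Finset.insert_Ico_right_eq_Ico_add_one h, Finset.sum_insert (by simp)]
    simp [add_comm]
  · rw [Finset.Ico_eq_empty (a := 0) (b := m + 1) (by omega),
      Finset.Ico_eq_empty (a := 0) (b := m) (by omega),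
      ← Finset.insert_Ico_add_one_left_eq_Ico h, Finset.sum_insert (by simp)]
    simp

/-- The phase space `X^f = {(x, s) : 0 ≤ s < f(x)}`. -/
abbrev Space (f : X → ℝ) : Type _ := {p : X × ℝ // 0 ≤ p.2 ∧ p.2 < f p.1}

/-- The restriction `μ^f` of `μ × λ` to `X^f`, with `λ` Lebesgue measure on `ℝ`. -/
def measure [MeasurableSpace X] (μ : Measure X) (f : X → ℝ) : Measure (Space f) :=
  (μ.prod volume).comap Subtype.val

/-- The measure `μ^f`, divided by its total mass. -/
def probMeasure [MeasurableSpace X] (μ : Measure X) (f : X → ℝ) : Measure (Space f) :=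
  (measure μ f univ)⁻¹ • measure μ f

/-- `n` is the number of passages through the roof made by `(x, s)` up to time `t`, where
`r = s + t`: `f^{(n)}(x) ≤ r < f^{(n+1)}(x)`. -/
def IsPassage (T : Equiv.Perm X) (f : X → ℝ) (x : X) (r : ℝ) (n : ℤ) : Prop :=
  cocycle T f n x ≤ r ∧ r < cocycle T f (n + 1) x

open Classical in
/-- The special flow `T_t^f(x, s) = (T^n x, s + t - f^{(n)}(x))`, where `n` is the integer with
`f^{(n)}(x) ≤ s + t < f^{(n+1)}(x)`. (If there were no such `n`, the value would be `(x, s)`.) -/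
def flow (T : Equiv.Perm X) (f : X → ℝ) (t : ℝ) (p : Space f) : Space f :=
  if h : ∃ n : ℤ, IsPassage T f p.1.1 (p.1.2 + t) n then
    ⟨((T ^ h.choose) p.1.1, p.1.2 + t - cocycle T f h.choose p.1.1), by
      have h1 := h.choose_spec.1
      have h2 := h.choose_spec.2
      rw [cocycle_succ] at h2
      constructor <;> dsimp only <;> linarith⟩
  else p

end Special

/-! ### Flows on probability spaces -/

section Mixing

variable {Y : Type*} [MeasurableSpace Y]

/-- A measurable, measure-preserving flow on a probability space. -/
structure IsMeasurePreservingFlow (S : ℝ → Y → Y) (μ : Measure Y) : Prop where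
  isProbabilityMeasure : IsProbabilityMeasure μ
  map_zero : ∀ y, S 0 y = y
  map_add : ∀ s t y, S (s + t) y = S s (S t y)
  measurable : Measurable fun q : ℝ × Y => S q.1 q.2
  measurePreserving : ∀ t, MeasurePreserving (S t) μ μ

/-- Ergodicity: every (almost) invariant measurable set has measure `0` or `1`. -/
def IsErgodicFlow (S : ℝ → Y → Y) (μ : Measure Y) : Prop :=
  ∀ A : Set Y, MeasurableSet A → (∀ t, S t ⁻¹' A =ᵐ[μ] A) → μ A = 0 ∨ μ A = 1

/-- A weakly mixing flow: an ergodic measurable measure-preserving flow such that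
`(1/τ) ∫₀^τ |μ(S_t A ∩ B) - μ(A) μ(B)| dt → 0` as `τ → +∞`, for all measurable `A`, `B`. -/
structure IsWeaklyMixing (S : ℝ → Y → Y) (μ : Measure Y) : Prop where
  isFlow : IsMeasurePreservingFlow S μ
  ergodic : IsErgodicFlow S μ
  mixing : ∀ A B : Set Y, MeasurableSet A → MeasurableSet B →
    Tendsto (fun τ : ℝ =>
        (1 / τ) * ∫ t in (0 : ℝ)..τ, |μ.real (S t '' A ∩ B) - μ.real A * μ.real B|)
      atTop (𝓝 0)

end Mixing

end SpecialFlow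

end

/-! Weak mixing is obtained as double ergodicity: with `U` the Koopman representation on `L²`, it
suffices that every measurable `L²`-valued `F` on the phase space satisfying `U_t F(T^f_t y) = F(y)`
a.e. for each `t` is a.e. equal to one `U`-fixed vector, and that `U`-fixed vectors are constant
functions. Following `F` along flow lines reduces this to the base: a solution of `φ(x) = U_{f(x)}
φ(x + α)` must be a.e. constant, with a `U`-fixed value.

The heart is `ae_fixed_of_cocycle`. Take `q` with `qα` near `0` and compare `x` with `x + a/q`.
Iterating the equation `q` times at both points and using continuity of translations in `L¹`, one
sees that `t = f^{(q)}(x + a/q) - f^{(q)}(x)` nearly fixes `φ(x)` for most `x`. This `t` is close to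
`-S(f)a` with high probability (`eventually_volume_orbitIncrement_le`): the absolutely continuous
part contributes about `-S(f)a` by the mean ergodic theorem, since `∫ f_a' = -S(f)` by periodicity;
a finite set of main jumps is met only with probability at most `Ka`; the other jumps are small in
`L¹`.

By compactness, outside a set of measure at most `Ka + ε` the vector `φ(x)` has an exact period `t`
with `|t + S(f)a| ≤ |S(f)|a/2`. Such a `t` is nonzero and of order `a`. Since `K` does not depend on
`a`, letting `a → 0` and then `ε → 0` gives almost every `φ(x)` arbitrarily small nonzero periods,
so its closed group of periods is all of `ℝ`. The equation then says that `φ` is rotation invariant,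
hence constant by ergodicity. -/

noncomputable section

namespace SpecialFlow

/-! ### The special flow as vertical translation on the quotient of `X × ℝ` by a `ℤ`-action -/

section Algebra

variable {X : Type*} {T : Equiv.Perm X} {f : X → ℝ}

theorem cocycle_zero (x : X) : cocycle T f 0 x = 0 := by simp [cocycle]

theorem cocycle_one (x : X) : cocycle T f 1 x = f x := by
  have := cocycle_succ T f 0 x
  simpa [cocycle_zero] using this

theorem cocycle_add (m n : ℤ) (x : X) :
    cocycle T f (m + n) x = cocycle T f m x + cocycle T f n ((T ^ m) x) := by
  have key (k : ℤ) : (T ^ k) ((T ^ m) x) = (T ^ (m + k)) x := by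
    rw [← Equiv.Perm.mul_apply, ← zpow_add, add_comm]
  induction n using Int.induction_on with
  | zero => simp [cocycle_zero]
  | succ n ih => rw [← add_assoc, cocycle_succ, cocycle_succ, ih, key, add_assoc]
  | pred n ih =>
    have h1 := cocycle_succ T f (m + (-n - 1)) x
    have h2 := cocycle_succ T f (-n - 1) ((T ^ m) x)
    rw [key] at h2
    rw [show m + (-(n : ℤ) - 1) + 1 = m + -n by ring, ih] at h1
    rw [show -(n : ℤ) - 1 + 1 = -n by ring] at h2
    linarith

theorem cocycle_strictMono (hpos : ∀ x, 0 < f x) (x : X) :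
    StrictMono fun n : ℤ => cocycle T f n x :=
  strictMono_int_of_lt_succ fun n => by
    rw [cocycle_succ]; linarith [hpos ((T ^ n) x)]

/-- By the cocycle identity, moving along a `ℤ`-orbit only shifts the passage number. This is what
makes `proj` constant on orbits. -/
theorem isPassage_skew {x : X} {r : ℝ} {m n : ℤ} :
    IsPassage T f ((T ^ m) x) (r - cocycle T f m x) n ↔ IsPassage T f x r (m + n) := by
  unfold IsPassage
  rw [add_assoc, cocycle_add m n, cocycle_add m (n + 1)]
  constructor <;> rintro ⟨h1, h2⟩ <;> constructor <;> linarith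

theorem isPassage_zero {x : X} {r : ℝ} : IsPassage T f x r 0 ↔ 0 ≤ r ∧ r < f x := by
  simp [IsPassage, cocycle_zero, cocycle_one]

/-- The action of `n ∈ ℤ` on `X × ℝ` whose quotient is the phase space of the special flow. -/
def skewMap (T : Equiv.Perm X) (f : X → ℝ) (n : ℤ) (p : X × ℝ) : X × ℝ :=
  ((T ^ n) p.1, p.2 - cocycle T f n p.1)

theorem skewMap_skewMap_neg (n : ℤ) (p : X × ℝ) :
    skewMap T f n (skewMap T f (-n) p) = p := by
  have h := cocycle_add (T := T) (f := f) (-n) n p.1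
  rw [neg_add_cancel, cocycle_zero] at h
  ext
  · simp [skewMap]
  · simp only [skewMap]; linarith

theorem isPassage_iff_skewMap {p : X × ℝ} {n : ℤ} :
    IsPassage T f p.1 p.2 n ↔
      0 ≤ (skewMap T f n p).2 ∧ (skewMap T f n p).2 < f (skewMap T f n p).1 := by
  rw [← isPassage_zero (T := T), skewMap, isPassage_skew, add_zero]

/-- The projection of `X × ℝ` to the phase space of the special flow. -/
def proj (T : Equiv.Perm X) (hpos : ∀ x, 0 < f x) (p : X × ℝ) : Space f :=
  flow T f p.2 ⟨(p.1, 0), le_rfl, hpos p.1⟩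

theorem flow_val (hpass : ∀ x r, ∃! n : ℤ, IsPassage T f x r n)
    {t : ℝ} {p : Space f} {n : ℤ} (h : IsPassage T f p.1.1 (p.1.2 + t) n) :
    (flow T f t p : X × ℝ) = skewMap T f n (p.1.1, p.1.2 + t) := by
  have hex : ∃ n : ℤ, IsPassage T f p.1.1 (p.1.2 + t) n := ⟨n, h⟩
  have hn : hex.choose = n := (hpass _ _).unique hex.choose_spec h
  rw [flow, dif_pos hex]
  simp only [hn, skewMap]

theorem proj_val (hpos : ∀ x, 0 < f x)
    (hpass : ∀ x r, ∃! n : ℤ, IsPassage T f x r n)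
    {p : X × ℝ} {n : ℤ} (h : IsPassage T f p.1 p.2 n) :
    (proj T hpos p : X × ℝ) = skewMap T f n p := by
  rw [proj, flow_val hpass (n := n)] <;> simp [h]

theorem flow_eq_proj (hpos : ∀ x, 0 < f x)
    (hpass : ∀ x r, ∃! n : ℤ, IsPassage T f x r n)
    (t : ℝ) (p : Space f) :
    flow T f t p = proj T hpos (p.1.1, p.1.2 + t) := by
  obtain ⟨n, hn, -⟩ := hpass p.1.1 (p.1.2 + t)
  exact Subtype.ext ((flow_val hpass hn).trans
    (proj_val hpos hpass (p := (p.1.1, p.1.2 + t)) hn).symm)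

theorem proj_skewMap (hpos : ∀ x, 0 < f x)
    (hpass : ∀ x r, ∃! n : ℤ, IsPassage T f x r n)
    (m : ℤ) (p : X × ℝ) :
    proj T hpos (skewMap T f m p) = proj T hpos p := by
  obtain ⟨n, hn, -⟩ := hpass (skewMap T f m p).1 (skewMap T f m p).2
  have hn' : IsPassage T f p.1 p.2 (m + n) := isPassage_skew.1 hn
  apply Subtype.ext
  rw [proj_val hpos hpass hn, proj_val hpos hpass hn']
  ext
  · simp only [skewMap]
    rw [← Equiv.Perm.mul_apply, ← zpow_add, add_comm]
  · simp only [skewMap, cocycle_add]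
    ring

theorem proj_coe (hpos : ∀ x, 0 < f x)
    (hpass : ∀ x r, ∃! n : ℤ, IsPassage T f x r n)
    (p : Space f) : proj T hpos p = p := by
  apply Subtype.ext
  rw [proj_val hpos hpass (n := 0) (isPassage_zero.2 p.2)]
  simp [skewMap, cocycle_zero]

theorem proj_apply_succ (hpos : ∀ x, 0 < f x)
    (hpass : ∀ x r, ∃! n : ℤ, IsPassage T f x r n)
    (x : X) (s : ℝ) :
    proj T hpos (T x, s) = proj T hpos (x, s + f x) := by
  rw [← proj_skewMap hpos hpass 1 (x, s + f x)]
  simp [skewMap, cocycle_one]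

/-- Vertical translation commutes with the `ℤ`-action and so descends to the quotient; the group law
of the flow follows from this. -/
theorem flow_proj (hpos : ∀ x, 0 < f x)
    (hpass : ∀ x r, ∃! n : ℤ, IsPassage T f x r n)
    (t : ℝ) (p : X × ℝ) :
    flow T f t (proj T hpos p) = proj T hpos (p.1, p.2 + t) := by
  obtain ⟨n, hn, -⟩ := hpass p.1 p.2
  rw [flow_eq_proj hpos hpass, proj_val hpos hpass hn,
    ← proj_skewMap hpos hpass n (p.1, p.2 + t)]
  congr 1
  ext
  · rfl
  · simp only [skewMap]; ring

theorem flow_zero (hpos : ∀ x, 0 < f x)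
    (hpass : ∀ x r, ∃! n : ℤ, IsPassage T f x r n)
    (p : Space f) : flow T f 0 p = p := by
  rw [flow_eq_proj hpos hpass, add_zero, proj_coe hpos hpass]

theorem flow_add (hpos : ∀ x, 0 < f x)
    (hpass : ∀ x r, ∃! n : ℤ, IsPassage T f x r n)
    (s t : ℝ) (p : Space f) :
    flow T f (s + t) p = flow T f s (flow T f t p) := by
  rw [flow_eq_proj hpos hpass t, flow_proj hpos hpass, flow_eq_proj hpos hpass, add_assoc,
    add_comm t s]

theorem iUnion_isPassage (hpass : ∀ x r, ∃! n : ℤ, IsPassage T f x r n) :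
    ⋃ n, {p : X × ℝ | IsPassage T f p.1 p.2 n} = univ :=
  eq_univ_of_forall fun p => mem_iUnion.2 (hpass p.1 p.2).exists

theorem pairwise_disjoint_isPassage (hpass : ∀ x r, ∃! n : ℤ, IsPassage T f x r n) :
    Pairwise (Function.onFun Disjoint fun n => {p : X × ℝ | IsPassage T f p.1 p.2 n}) :=
  fun _ _ hmn => disjoint_left.2 fun p hm hn => hmn ((hpass p.1 p.2).unique hm hn)

end Algebra

/-! ### Measurability of the flow and invariance of the measure -/

section Measure

variable {X : Type*} [MeasurableSpace X] {T : Equiv.Perm X} {f : X → ℝ} {μ : Measure X}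

theorem measurableSet_space (hf : Measurable f) :
    MeasurableSet {p : X × ℝ | 0 ≤ p.2 ∧ p.2 < f p.1} :=
  (measurableSet_le measurable_const measurable_snd).inter
    (measurableSet_lt measurable_snd (hf.comp measurable_fst))

theorem measurable_cocycle (hT : ∀ n : ℤ, Measurable (T ^ n)) (hf : Measurable f) (n : ℤ) :
    Measurable (cocycle T f n) := by
  unfold cocycle
  exact (Finset.measurable_sum _ fun k _ => hf.comp (hT k)).sub
    (Finset.measurable_sum _ fun k _ => hf.comp (hT k))

theorem measurable_skewMap (hT : ∀ n : ℤ, Measurable (T ^ n)) (hf : Measurable f) (n : ℤ) :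
    Measurable (skewMap T f n) :=
  ((hT n).comp measurable_fst).prodMk
    (measurable_snd.sub ((measurable_cocycle hT hf n).comp measurable_fst))

theorem measurableSet_isPassage (hT : ∀ n : ℤ, Measurable (T ^ n)) (hf : Measurable f) (n : ℤ) :
    MeasurableSet {p : X × ℝ | IsPassage T f p.1 p.2 n} := by
  simp_rw [isPassage_iff_skewMap]
  exact measurable_skewMap hT hf n (measurableSet_space hf)

theorem measurePreserving_skewMap [SFinite μ] (hT : ∀ n : ℤ, MeasurePreserving (T ^ n) μ μ)
    (hf : Measurable f) (n : ℤ) :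
    MeasurePreserving (skewMap T f n) (μ.prod volume) (μ.prod volume) := by
  refine MeasurePreserving.skew_product (g := fun x s => s - cocycle T f n x) (hT n) ?_ ?_
  · exact measurable_snd.sub
      ((measurable_cocycle (fun n => (hT n).measurable) hf n).comp measurable_fst)
  · exact Eventually.of_forall fun x => (measurePreserving_sub_right volume _).map_eq

variable (hpos : ∀ x, 0 < f x)

theorem measurable_proj (hT : ∀ n : ℤ, Measurable (T ^ n)) (hf : Measurable f)
    (hpass : ∀ x r, ∃! n : ℤ, IsPassage T f x r n) : Measurable (proj T hpos) := by
  refine (MeasurableEmbedding.subtype_coe (measurableSet_space hf)).measurable_comp_iff.1 ?_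
  intro E hE
  have : ((fun p => (proj T hpos p : X × ℝ)) ⁻¹' E) =
      ⋃ n : ℤ, {p : X × ℝ | IsPassage T f p.1 p.2 n} ∩ skewMap T f n ⁻¹' E := by
    ext p
    obtain ⟨n, hn, hu⟩ := hpass p.1 p.2
    simp only [mem_preimage, mem_iUnion, mem_inter_iff, mem_ofPred_eq]
    constructor
    · intro h
      exact ⟨n, hn, by rwa [← proj_val hpos hpass hn]⟩
    · rintro ⟨m, hm, h⟩
      rwa [proj_val hpos hpass hm]
  exact this ▸ MeasurableSet.iUnion fun n =>
    (measurableSet_isPassage hT hf n).inter (measurable_skewMap hT hf n hE)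

theorem measurable_flow (hpos : ∀ x, 0 < f x) (hT : ∀ n : ℤ, Measurable (T ^ n))
    (hf : Measurable f) (hpass : ∀ x r, ∃! n : ℤ, IsPassage T f x r n) :
    Measurable fun q : ℝ × Space f => flow T f q.1 q.2 := by
  simp_rw [flow_eq_proj hpos hpass]
  refine (measurable_proj hpos hT hf hpass).comp ?_
  have h : Measurable fun q : ℝ × Space f => (q.2 : X × ℝ) :=
    measurable_subtype_coe.comp measurable_snd
  exact (measurable_fst.comp h).prodMk ((measurable_snd.comp h).add measurable_fst)

theorem measure_apply (hf : Measurable f) (E : Set (Space f)) :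
    measure μ f E = μ.prod volume (Subtype.val '' E) :=
  (MeasurableEmbedding.subtype_coe (measurableSet_space hf)).comap_apply _ _

/-- The exceptional set upstairs is covered by countably many preimages of one null set under the
measure-preserving maps `skewMap`. -/
theorem ae_proj_of_ae [SFinite μ] (hT : ∀ n : ℤ, MeasurePreserving (T ^ n) μ μ)
    (hf : Measurable f)
    (hpass : ∀ x r, ∃! n : ℤ, IsPassage T f x r n) {P : Space f → Prop}
    (h : ∀ᵐ y ∂measure μ f, P y) : ∀ᵐ p ∂μ.prod volume, P (proj T hpos p) := by
  rw [ae_iff, measure_apply hf] at h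
  have h' (n : ℤ) := (measurePreserving_skewMap hT hf n).quasiMeasurePreserving.ae
    (measure_eq_zero_iff_ae_notMem.1 h)
  filter_upwards [ae_all_iff.2 h'] with p hp
  obtain ⟨n, hn, -⟩ := hpass p.1 p.2
  by_contra hP
  exact hp n (proj_val hpos hpass hn ▸ mem_image_of_mem _ hP)

theorem ae_of_ae_proj (hf : Measurable f)
    (hpass : ∀ x r, ∃! n : ℤ, IsPassage T f x r n) {P : Space f → Prop}
    (h : ∀ᵐ p ∂μ.prod volume, P (proj T hpos p)) : ∀ᵐ y ∂measure μ f, P y := by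
  rw [ae_iff] at h ⊢
  rw [measure_apply hf]
  refine measure_mono_null ?_ h
  rintro _ ⟨y, hy, rfl⟩
  simpa [proj_coe hpos hpass] using hy

/-- The phase space `Y` and its vertical translate `S ⁻¹' Y` are two fundamental domains of the same
measure-preserving `ℤ`-action, so they meet the invariant set `E'` in equal measure. -/
theorem measure_flow_preimage [SFinite μ] (hpos : ∀ x, 0 < f x)
    (hT : ∀ n : ℤ, MeasurePreserving (T ^ n) μ μ)
    (hf : Measurable f) (hpass : ∀ x r, ∃! n : ℤ, IsPassage T f x r n) (t : ℝ)
    {E : Set (Space f)} (hE : MeasurableSet E) :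
    measure μ f (flow T f t ⁻¹' E) = measure μ f E := by
  have hT' (n : ℤ) := (hT n).measurable
  set Y : Set (X × ℝ) := {p : X × ℝ | 0 ≤ p.2 ∧ p.2 < f p.1}
  have hY : MeasurableSet Y := measurableSet_space hf
  set E' : Set (X × ℝ) := proj T hpos ⁻¹' E with hE'def
  have hE' : MeasurableSet E' := measurable_proj hpos hT' hf hpass hE
  set S : X × ℝ → X × ℝ := fun p => (p.1, p.2 - t)
  have hS : MeasurePreserving S (μ.prod volume) (μ.prod volume) :=
    (MeasurePreserving.id μ).prod (measurePreserving_sub_right volume t)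
  set P : ℤ → Set (X × ℝ) := fun n => {p | IsPassage T f p.1 p.2 n}
  have hP (n : ℤ) : P n = skewMap T f n ⁻¹' Y := by
    ext p; exact isPassage_iff_skewMap
  have hPm (n : ℤ) : MeasurableSet (P n) := measurableSet_isPassage hT' hf n
  have hcomm (n : ℤ) (p : X × ℝ) : S (skewMap T f n p) = skewMap T f n (S p) := by
    ext
    · rfl
    · simp only [S, skewMap]; ring
  have split {R : X × ℝ → X × ℝ} (hR : Measurable R) {A : Set (X × ℝ)} (hA : MeasurableSet A) :
      μ.prod volume A = ∑' n : ℤ, μ.prod volume (A ∩ R ⁻¹' P n) := by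
    rw [← measure_iUnion, ← inter_iUnion, ← preimage_iUnion, iUnion_isPassage hpass,
      preimage_univ, inter_univ]
    · exact fun m n hmn => ((pairwise_disjoint_isPassage hpass hmn).preimage R).mono
        inter_subset_right inter_subset_right
    · exact fun n => hA.inter (hR (hPm n))
  have h1 : measure μ f (flow T f t ⁻¹' E) = μ.prod volume (S ⁻¹' Y ∩ E') := by
    have hm : MeasurableSet (flow T f t ⁻¹' E) :=
      (measurable_flow hpos hT' hf hpass).comp (measurable_const.prodMk measurable_id) hE
    have hm' : MeasurableSet (Subtype.val '' (flow T f t ⁻¹' E)) :=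
      (MeasurableEmbedding.subtype_coe (measurableSet_space hf)).measurableSet_image.2 hm
    rw [measure_apply hf, ← hS.measure_preimage hm'.nullMeasurableSet]
    congr 1
    ext p
    simp only [mem_preimage, mem_image, mem_inter_iff, E']
    constructor
    · rintro ⟨y, hy, hyp⟩
      rw [flow_eq_proj hpos hpass, hyp] at hy
      exact ⟨hyp ▸ y.2, by simpa [S] using hy⟩
    · rintro ⟨h, h'⟩
      refine ⟨⟨S p, h⟩, ?_, rfl⟩
      rw [flow_eq_proj hpos hpass]
      simpa [S] using h'
  have h2 : measure μ f E = μ.prod volume (E' ∩ Y) := by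
    rw [measure_apply hf]
    congr 1
    ext p
    simp only [mem_image, mem_inter_iff, E', mem_preimage]
    constructor
    · rintro ⟨y, hy, rfl⟩
      exact ⟨by rwa [proj_coe hpos hpass], y.2⟩
    · rintro ⟨h, h'⟩
      exact ⟨⟨p, h'⟩, by rwa [← proj_coe hpos hpass ⟨p, h'⟩], rfl⟩
  have hSE : MeasurableSet (S ⁻¹' Y ∩ E') := (hS.measurable hY).inter hE'
  -- Each domain is cut by the translates of the other. The piece of index `-n` on the left
  -- corresponds under `skewMap T f n` to the piece of index `n` on the right.
  rw [h1, h2, split measurable_id hSE, split hS.measurable (hE'.inter hY),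
    ← (Equiv.neg ℤ).tsum_eq]
  refine tsum_congr fun n => ?_
  rw [Equiv.neg_apply, preimage_id, ← (measurePreserving_skewMap hT hf n).measure_preimage
    (hSE.inter (hPm (-n))).nullMeasurableSet]
  congr 1
  ext p
  have e1 : skewMap T f n p ∈ P (-n) ↔ p ∈ Y := by
    have := skewMap_skewMap_neg (T := T) (f := f) (-n) p
    rw [neg_neg] at this
    rw [hP, mem_preimage, this]
  have e2 : S (skewMap T f n p) ∈ Y ↔ S p ∈ P n := by
    rw [hP, mem_preimage, hcomm]
  have e3 : skewMap T f n p ∈ E' ↔ p ∈ E' := by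
    simp only [E', mem_preimage, proj_skewMap hpos hpass]
  simp only [mem_preimage, mem_inter_iff, e1, e2, e3]
  tauto

theorem measure_univ_eq [SFinite μ] (hf : Measurable f) :
    measure μ f univ = ∫⁻ x, ENNReal.ofReal (f x) ∂μ := by
  rw [measure_apply hf, image_univ, Subtype.range_coe_subtype,
    Measure.prod_apply (measurableSet_space hf)]
  refine lintegral_congr fun x => ?_
  have : Prod.mk x ⁻¹' {p : X × ℝ | 0 ≤ p.2 ∧ p.2 < f p.1} = Ico 0 (f x) := by
    ext s; simp
  rw [this, Real.volume_Ico, sub_zero]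

theorem measure_univ_ne_zero [SFinite μ] [NeZero μ] (hpos : ∀ x, 0 < f x) (hf : Measurable f) :
    measure μ f univ ≠ 0 := by
  rw [measure_univ_eq hf, Ne, lintegral_eq_zero_iff hf.ennreal_ofReal]
  intro h
  obtain ⟨x, hx⟩ := h.exists
  exact (hpos x).not_ge (ENNReal.ofReal_eq_zero.1 hx)

theorem measure_univ_ne_top [SFinite μ] (hf : Measurable f) (hfi : Integrable f μ) :
    measure μ f univ ≠ ⊤ := by
  rw [measure_univ_eq hf]
  exact hfi.lintegral_lt_top.ne

theorem isProbabilityMeasure_probMeasure [SFinite μ] [NeZero μ] (hpos : ∀ x, 0 < f x)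
    (hf : Measurable f) (hfi : Integrable f μ) : IsProbabilityMeasure (probMeasure μ f) :=
  ⟨by rw [probMeasure, Measure.smul_apply, smul_eq_mul,
    ENNReal.inv_mul_cancel (measure_univ_ne_zero hpos hf) (measure_univ_ne_top hf hfi)]⟩

theorem measurePreserving_flow [SFinite μ] (hpos : ∀ x, 0 < f x)
    (hT : ∀ n : ℤ, MeasurePreserving (T ^ n) μ μ) (hf : Measurable f)
    (hpass : ∀ x r, ∃! n : ℤ, IsPassage T f x r n) (t : ℝ) :
    MeasurePreserving (flow T f t) (probMeasure μ f) (probMeasure μ f) := by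
  have h : Measurable (Function.uncurry (flow T f)) :=
    measurable_flow hpos (fun n => (hT n).measurable) hf hpass
  have hm : Measurable (flow T f t) := h.of_uncurry_left
  refine ⟨hm, ?_⟩
  ext E hE
  have := measure_flow_preimage hpos hT hf hpass t hE
  rw [Measure.map_apply hm hE, probMeasure, Measure.smul_apply, Measure.smul_apply, this]

theorem isMeasurePreservingFlow [SFinite μ] [NeZero μ] (hpos : ∀ x, 0 < f x)
    (hT : ∀ n : ℤ, MeasurePreserving (T ^ n) μ μ) (hf : Measurable f) (hfi : Integrable f μ)
    (hpass : ∀ x r, ∃! n : ℤ, IsPassage T f x r n) :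
    IsMeasurePreservingFlow (flow T f) (probMeasure μ f) where
  isProbabilityMeasure := isProbabilityMeasure_probMeasure hpos hf hfi
  map_zero := flow_zero hpos hpass
  map_add := flow_add hpos hpass
  measurable := measurable_flow hpos (fun n => (hT n).measurable) hf hpass
  measurePreserving := measurePreserving_flow hpos hT hf hpass

theorem ae_probMeasure_iff [SFinite μ] (hf : Measurable f) (hfi : Integrable f μ)
    {P : Space f → Prop} : (∀ᵐ y ∂probMeasure μ f, P y) ↔ ∀ᵐ y ∂measure μ f, P y := by
  rw [probMeasure, Measure.ae_ennreal_smul_measure_iff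
    (ENNReal.inv_ne_zero.2 (measure_univ_ne_top hf hfi))]

end Measure

/-- A strongly continuous action of `ℝ` by linear isometries. -/
structure IsIsometricAction {H : Type*} [NormedAddCommGroup H] [NormedSpace ℝ H]
    (U : ℝ → H →ₗᵢ[ℝ] H) : Prop where
  map_zero : ∀ h, U 0 h = h
  map_add : ∀ s t h, U (s + t) h = U s (U t h)
  continuous : ∀ h, Continuous fun t => U t h

namespace IsIsometricAction

variable {H : Type*} [NormedAddCommGroup H] [NormedSpace ℝ H] {U : ℝ → H →ₗᵢ[ℝ] H}

theorem continuous_uncurry (hU : IsIsometricAction U) : Continuous fun q : ℝ × H => U q.1 q.2 :=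
  continuous_prod_of_continuous_lipschitzWith' _ 1 (fun t => (U t).lipschitz) hU.continuous

theorem neg_apply_apply (hU : IsIsometricAction U) (t : ℝ) (h : H) : U (-t) (U t h) = h := by
  rw [← hU.map_add, neg_add_cancel, hU.map_zero]

end IsIsometricAction

/-! ### Equivariant functions: from the phase space to the base -/

section Suspension

variable {X : Type*} [MeasurableSpace X] {T : Equiv.Perm X} {f : X → ℝ} {μ : Measure X}
variable {H : Type*} [NormedAddCommGroup H] [NormedSpace ℝ H] {U : ℝ → H →ₗᵢ[ℝ] H}

/-- An equivariant function on the phase space of the special flow comes from an equivariant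
function on the base. -/
theorem ae_eq_const_of_equivariant [SFinite μ] (hpos : ∀ x, 0 < f x)
    (hT : ∀ n : ℤ, MeasurePreserving (T ^ n) μ μ) (hf : Measurable f)
    (hpass : ∀ x r, ∃! n : ℤ, IsPassage T f x r n) (hU : IsIsometricAction U)
    {F : Space f → H} (hF : StronglyMeasurable F)
    (hinv : ∀ t, ∀ᵐ y ∂measure μ f, U t (F (flow T f t y)) = F y)
    (hφ : ∀ φ : X → H, StronglyMeasurable φ → (∀ᵐ x ∂μ, φ x = U (f x) (φ (T x))) →
      ∃ h, (∀ t, U t h = h) ∧ ∀ᵐ x ∂μ, φ x = h) :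
    ∃ h, (∀ t, U t h = h) ∧ ∀ᵐ y ∂measure μ f, F y = h := by
  -- Twisting by `U` along the fibre turns equivariance of `F` into a.e. invariance of `G` under
  -- vertical translations, so `G` depends only on `x` up to null sets.
  set G : X × ℝ → H := fun p => U p.2 (F (proj T hpos p))
  have hG : StronglyMeasurable G := hU.continuous_uncurry.comp_stronglyMeasurable
    (measurable_snd.stronglyMeasurable.prodMk
      (hF.comp_measurable (measurable_proj hpos (fun n => (hT n).measurable) hf hpass)))
  have h1 (t : ℝ) : ∀ᵐ p ∂μ.prod volume, G (p.1, p.2 + t) = G p := by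
    filter_upwards [ae_proj_of_ae hpos hT hf hpass (hinv t)] with p hp
    simp only [G]
    rw [hU.map_add, ← flow_proj hpos hpass, hp]
  have h2 : ∀ᵐ p ∂μ.prod volume, ∀ᵐ t : ℝ, G (p.1, p.2 + t) = G p := by
    refine (Measure.ae_ae_comm ?_).1 (Eventually.of_forall h1 :
      ∀ᵐ t : ℝ, ∀ᵐ p ∂μ.prod volume, G (p.1, p.2 + t) = G p)
    refine StronglyMeasurable.measurableSet_eq_fun (hG.comp_measurable ?_)
      (hG.comp_measurable measurable_snd)
    fun_prop
  have h3 : ∀ᵐ p ∂μ.prod volume, ∀ᵐ t : ℝ, G (p.1, t) = G p := by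
    filter_upwards [h2] with p hp
    filter_upwards [(measurePreserving_sub_right volume p.2).quasiMeasurePreserving.ae hp]
      with t ht
    simpa using ht
  -- Fubini provides one height `s` at which `G (x, s)` is the essential value of `G (x, ·)` for
  -- a.e. `x`.
  obtain ⟨s, hs⟩ := (Measure.ae_ae_of_ae_prod
    (Measure.measurePreserving_swap.quasiMeasurePreserving.ae h3)).exists
  have hφm : StronglyMeasurable fun x => G (x, s) := hG.comp_measurable measurable_prodMk_right
  have hT1 : MeasurePreserving T μ μ := by simpa using hT 1
  have hshift (x : X) (t : ℝ) : U (f x) (G (T x, t)) = G (x, t + f x) := by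
    simp only [G]
    rw [← hU.map_add, proj_apply_succ hpos hpass, add_comm (f x)]
  obtain ⟨h, hUh, hh⟩ := hφ _ hφm <| by
    filter_upwards [hs, hT1.quasiMeasurePreserving.ae hs] with x hx hTx
    -- The points `(T x, t)` and `(x, t + f x)` have the same projection; a height `t` generic for
    -- both fibres turns this into the equation for `φ`.
    obtain ⟨t, ht1, ht2⟩ := ((measurePreserving_add_right volume
      (f x)).quasiMeasurePreserving.ae hx |>.and hTx).exists
    simp only [Prod.swap_prod_mk] at ht1 ht2
    rw [← ht1, ← ht2, hshift]
  refine ⟨h, hUh, ae_of_ae_proj hpos hf hpass ?_⟩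
  have hGh : ∀ᵐ p ∂μ.prod volume, G p = h := by
    rw [Measure.ae_prod_iff_ae_ae
      (StronglyMeasurable.measurableSet_eq_fun hG stronglyMeasurable_const)]
    filter_upwards [hs, hh] with x hx hxh
    filter_upwards [hx] with t ht
    exact ht.trans hxh
  filter_upwards [hGh] with p hp
  rw [← hU.neg_apply_apply p.2 (F _), show U p.2 (F (proj T hpos p)) = h from hp, hUh]

end Suspension

/-! ### Arcs and step functions on the circle -/

section Circle

/-- The representative in `[0, 1)` of a point of the circle. -/
def frac (u : UnitAddCircle) : ℝ := AddCircle.equivIco 1 0 u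

theorem frac_coe (t : ℝ) : frac (t : UnitAddCircle) = Int.fract t := by
  simp [frac, AddCircle.coe_equivIco_mk_apply]

theorem frac_mem (u : UnitAddCircle) : frac u ∈ Ico (0 : ℝ) 1 := by
  simpa [frac] using (AddCircle.equivIco 1 0 u).2

theorem coe_frac (u : UnitAddCircle) : (frac u : UnitAddCircle) = u :=
  AddCircle.coe_equivIco

theorem measurable_frac : Measurable frac :=
  measurable_subtype_coe.comp (AddCircle.measurableEquivIco 1 0).measurable

theorem measurePreserving_frac :
    MeasurePreserving frac volume (volume.restrict (Ico (0 : ℝ) 1)) := by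
  refine ⟨measurable_frac, ?_⟩
  have h := UnitAddCircle.measurePreserving_mk 0
  rw [← h.map_eq, Measure.map_map measurable_frac h.measurable, zero_add,
    Measure.restrict_congr_set Ioo_ae_eq_Ico.symm, Measure.restrict_congr_set Ioo_ae_eq_Ioc.symm]
  conv_rhs => rw [← Measure.map_id (μ := volume.restrict (Ioo (0 : ℝ) 1))]
  refine Measure.map_congr ?_
  filter_upwards [ae_restrict_mem measurableSet_Ioo] with t ht
  simp only [Function.comp_apply, id]
  exact (frac_coe t).trans (Int.fract_eq_self.2 ⟨ht.1.le, ht.2⟩)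

theorem integral_frac {h : ℝ → ℝ} (hh : AEStronglyMeasurable h (volume.restrict (Ico (0 : ℝ) 1))) :
    ∫ u, h (frac u) = ∫ t in Ico (0 : ℝ) 1, h t := by
  rw [← measurePreserving_frac.map_eq, integral_map measurable_frac.aemeasurable
    (by rwa [measurePreserving_frac.map_eq])]

/-- The indicator function of the arc `[0, δ)`. -/
def arcInd (δ : ℝ) (u : UnitAddCircle) : ℝ := if frac u < δ then 1 else 0

theorem measurable_arcInd (δ : ℝ) : Measurable (arcInd δ) :=
  Measurable.ite (measurableSet_lt measurable_frac measurable_const) measurable_const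
    measurable_const

theorem volume_arc {δ : ℝ} (hδ : δ ≤ 1) : volume {u | frac u < δ} = ENNReal.ofReal δ := by
  rw [show {u | frac u < δ} = frac ⁻¹' Iio δ from rfl,
    measurePreserving_frac.measure_preimage measurableSet_Iio.nullMeasurableSet,
    Measure.restrict_apply measurableSet_Iio]
  have : Iio δ ∩ Ico 0 1 = Ico 0 δ := by
    ext t; simp only [mem_inter_iff, mem_Iio, mem_Ico]; constructor
    · rintro ⟨h, h1, -⟩; exact ⟨h1, h⟩
    · rintro ⟨h, h1⟩; exact ⟨h1, h, h1.trans_le hδ⟩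
  rw [this, Real.volume_Ico, sub_zero]

theorem enorm_arcInd (δ : ℝ) (u : UnitAddCircle) :
    ‖arcInd δ u‖ₑ = {u | frac u < δ}.indicator 1 u := by
  by_cases h : frac u < δ <;> simp [arcInd, h]

theorem lintegral_enorm_arcInd {δ : ℝ} (hδ : δ ≤ 1) :
    ∫⁻ u, ‖arcInd δ u‖ₑ = ENNReal.ofReal δ := by
  simp_rw [enorm_arcInd]
  rw [lintegral_indicator_one (measurableSet_lt measurable_frac measurable_const), volume_arc hδ]

theorem integral_arcInd {δ : ℝ} (h0 : 0 ≤ δ) (hδ : δ ≤ 1) : ∫ u, arcInd δ u = δ := by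
  have : arcInd δ = {u | frac u < δ}.indicator 1 := by
    ext u; by_cases h : frac u < δ <;> simp [arcInd, h]
  rw [this, integral_indicator_one (measurableSet_lt measurable_frac measurable_const),
    measureReal_def, volume_arc hδ, ENNReal.toReal_ofReal h0]

theorem abs_arcInd_le (δ : ℝ) (u : UnitAddCircle) : |arcInd δ u| ≤ 1 := by
  by_cases h : frac u < δ <;> simp [arcInd, h]

/-- The increments of the indicator function of `{z | y < frac z}`. -/
theorem step_increment {δ : ℝ} (hδ : δ ∈ Ioo (0 : ℝ) 1) (u x : UnitAddCircle) :
    ((if frac u < frac (x + δ) then 1 else 0 : ℝ) - if frac u < frac x then 1 else 0) =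
      arcInd δ (u - x) - if 1 ≤ frac x + δ then 1 else 0 := by
  obtain ⟨hu0, hu1⟩ := frac_mem u
  obtain ⟨hx0, hx1⟩ := frac_mem x
  obtain ⟨hδ0, hδ1⟩ := hδ
  have h1 : frac (x + δ) = if 1 ≤ frac x + δ then frac x + δ - 1 else frac x + δ := by
    have : x + δ = ((frac x + δ : ℝ) : UnitAddCircle) := by
      rw [AddCircle.coe_add, coe_frac]
    rw [this, frac_coe]
    split_ifs with h
    · rw [Int.fract_eq_iff]
      exact ⟨by linarith, by linarith, 1, by simp⟩
    · exact Int.fract_eq_self.2 ⟨by linarith, by linarith⟩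
  have h2 : frac (u - x) = if frac u < frac x then frac u - frac x + 1 else frac u - frac x := by
    have : u - x = ((frac u - frac x : ℝ) : UnitAddCircle) := by
      rw [AddCircle.coe_sub, coe_frac, coe_frac]
    rw [this, frac_coe]
    split_ifs with h
    · rw [Int.fract_eq_iff]
      exact ⟨by linarith, by linarith, -1, by push_cast; ring⟩
    · exact Int.fract_eq_self.2 ⟨by linarith, by linarith⟩
  unfold arcInd
  rw [h1, h2]
  split_ifs <;> first | (exfalso; linarith) | norm_num

end Circle

/-! ### Increments of a function in `BV_{a+j}` as superpositions of arc indicators -/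

section Increment

variable {f : UnitAddCircle → ℝ}

theorem jumpPart_eq_tsum {x : ℝ} (hx : x ≤ 1) :
    jumpPart f x = ∑' y : Ico (0 : ℝ) 1, jump f y * if (y : ℝ) < x then 1 else 0 := by
  rw [jumpPart, tsum_subtype (Ico (0 : ℝ) x) (jump f),
    tsum_subtype (Ico (0 : ℝ) 1) fun y => jump f y * if y < x then 1 else 0]
  refine tsum_congr fun y => ?_
  by_cases h0 : 0 ≤ y <;> by_cases h1 : y < x
  · simp [h0, h1, h1.trans_le hx]
  all_goals simp [indicator, h0, h1]

/-- A divergent `tsum` has the value `0`, so a nonzero sum of jumps already entails summability. -/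
theorem summable_jump (hS : jumpSum f ≠ 0) : Summable fun y : Ico (0 : ℝ) 1 => jump f y := by
  by_contra h
  exact hS (tsum_eq_zero_of_not_summable h)

/-- The representation of a function in `BV_{a+j}` as a superposition of steps. -/
theorem IsBVaj.exists_steps (hf : IsBVaj f) : ∃ g : UnitAddCircle → ℝ,
    Measurable g ∧ Integrable g ∧ ∫ u, g u = -jumpSum f ∧ ∃ c, ∀ z, f z = c +
      ((∫ u, g u * if frac u < frac z then 1 else 0) +
        ∑' y : Ico (0 : ℝ) 1, jump f y * if (y : ℝ) < frac z then 1 else 0) := by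
  obtain ⟨fa, hfa, hdec⟩ := hf.decomposition
  have hint : IntegrableOn (deriv fa) (Ico 0 1) := by
    have := hfa.intervalIntegrable_deriv
    rwa [intervalIntegrable_iff_integrableOn_Ico_of_le zero_le_one] at this
  have hI (x : ℝ) (hx : x ∈ Icc (0 : ℝ) 1) :
      ∫ t in Ico (0 : ℝ) 1, deriv fa t * (if t < x then 1 else 0) = fa x - fa 0 := by
    have h1 : AbsolutelyContinuousOnInterval fa 0 x := hfa.mono <| by
      rw [uIcc_of_le hx.1, uIcc_of_le zero_le_one]; exact Icc_subset_Icc_right hx.2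
    rw [← h1.integral_deriv_eq_sub, intervalIntegral.integral_of_le hx.1,
      ← integral_Ico_eq_integral_Ioc]
    have : (fun t => deriv fa t * if t < x then 1 else 0) = (Iio x).indicator (deriv fa) := by
      ext t; by_cases h : t < x <;> simp [h]
    rw [this, setIntegral_indicator measurableSet_Iio]
    congr 2
    ext t; simp only [mem_inter_iff, mem_Iio, mem_Ico]; constructor
    · rintro ⟨⟨h, -⟩, h1⟩; exact ⟨h, h1⟩
    · rintro ⟨h, h1⟩; exact ⟨⟨h, h1.trans_le hx.2⟩, h1⟩
  have h0 := hdec 0 ⟨le_rfl, zero_le_one⟩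
  have h1 := hdec 1 ⟨zero_le_one, le_rfl⟩
  have hp0 : jumpPart f 0 = 0 := by simp [jumpPart]
  have hl : lift f 1 = lift f 0 := by simp [lift, AddCircle.coe_period]
  refine ⟨fun u => deriv fa (frac u), (measurable_deriv fa).comp measurable_frac, ?_, ?_,
    fa 0, fun z => ?_⟩
  · exact (measurePreserving_frac.integrable_comp hint.1).2 hint
  · rw [integral_frac hint.1]
    have h2 := hI 1 ⟨zero_le_one, le_rfl⟩
    have : ∫ t in Ico (0 : ℝ) 1, deriv fa t * (if t < 1 then 1 else 0) =
        ∫ t in Ico (0 : ℝ) 1, deriv fa t :=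
      setIntegral_congr_fun measurableSet_Ico fun t ht => by simp [ht.2]
    rw [← this, h2]
    -- Since `f(1) = f(0)`, the absolutely continuous part must undo the total jump: `fa 1 - fa 0 =
    -- -jumpSum f`.
    rw [hl, h0, hp0] at h1
    have : jumpPart f 1 = jumpSum f := rfl
    linarith
  · have hz := frac_mem z
    have hz' : frac z ∈ Icc (0 : ℝ) 1 := ⟨hz.1, hz.2.le⟩
    rw [integral_frac (h := fun t => deriv fa t * if t < frac z then 1 else 0), hI _ hz',
      ← jumpPart_eq_tsum hz'.2]
    · have := hdec _ hz'
      rw [lift, coe_frac] at this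
      rw [this]; ring
    · exact hint.1.mul (Measurable.ite measurableSet_Iio measurable_const
        measurable_const).aestronglyMeasurable

/-- By `step_increment`, each step contributes an arc indicator minus a wrap-around term that does
not depend on the position of the step. The wrap-around terms have total weight `∫ g + jumpSum f =
0` and cancel. -/
theorem IsBVaj.exists_increment (hf : IsBVaj f) (hS : jumpSum f ≠ 0) :
    ∃ (g : UnitAddCircle → ℝ) (J : Set ℝ) (d : J → ℝ), J.Countable ∧
      Measurable g ∧ Integrable g ∧ ∫ u, g u = -jumpSum f ∧ Summable d ∧
      ∀ δ ∈ Ioo (0 : ℝ) 1, ∀ x, f (x + δ) - f x =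
        (∫ u, g (u + x) * arcInd δ u) + ∑' y : J, d y * arcInd δ ((y : ℝ) - x) := by
  obtain ⟨g, hgm, hg, hgi, c, hfc⟩ := hf.exists_steps
  have hs := summable_jump hS
  -- Only points with a nonzero jump are kept: this makes the index set countable, as the later sums
  -- of measurable functions require.
  set J : Set ℝ := {y | y ∈ Ico (0 : ℝ) 1 ∧ jump f y ≠ 0} with hJ
  have hind {k : ℝ → ℝ} : ∑' y : Ico (0 : ℝ) 1, jump f y * k y = ∑' y : J, jump f y * k y := by
    rw [tsum_subtype (Ico (0 : ℝ) 1) fun y => jump f y * k y,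
      tsum_subtype J fun y => jump f y * k y]
    refine tsum_congr fun y => ?_
    by_cases h0 : y ∈ Ico (0 : ℝ) 1 <;> by_cases h1 : jump f y = 0 <;>
      simp [indicator, hJ, h1]
  have hJs : Summable fun y : J => jump f y :=
    hs.comp_injective (i := fun y : J => (⟨y, y.2.1⟩ : Ico (0 : ℝ) 1)) fun y z h => by
      simpa [Subtype.ext_iff] using h
  have hJt : ∑' y : J, jump f y = jumpSum f := by
    have := hind (k := fun _ => 1)
    simp only [mul_one] at this
    exact this.symm
  refine ⟨g, J, fun y => jump f y, ?_, hgm, hg, hgi, hJs, fun δ hδ x => ?_⟩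
  · refine (hs.countable_support.image Subtype.val).mono fun y hy => ?_
    exact ⟨⟨y, hy.1⟩, hy.2, rfl⟩
  set w : ℝ := if 1 ≤ frac x + δ then 1 else 0
  have hgk (z : UnitAddCircle) : Integrable fun u => g u * if frac u < frac z then 1 else 0 := by
    refine hg.mul_bdd (c := 1) (Measurable.ite (measurableSet_lt measurable_frac measurable_const)
      measurable_const measurable_const).aestronglyMeasurable (Eventually.of_forall fun u => ?_)
    split_ifs <;> simp
  have hga : Integrable fun u => g u * arcInd δ (u - x) :=
    hg.mul_bdd (c := 1) ((measurable_arcInd δ).comp (measurable_sub_const x)).aestronglyMeasurable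
      (Eventually.of_forall fun u => abs_arcInd_le δ _)
  have hsk (k : J → ℝ) (hk : ∀ y, |k y| ≤ 1) : Summable fun y : J => jump f y * k y := by
    refine Summable.of_norm_bounded hJs.abs fun y => ?_
    rw [norm_mul]
    exact mul_le_of_le_one_right (abs_nonneg _) (hk y)
  have hstep (z : UnitAddCircle) : Summable fun y : J =>
      jump f y * if (y : ℝ) < frac z then 1 else 0 :=
    hsk _ fun y => by split_ifs <;> simp
  have e1 : (∫ u, g u * if frac u < frac (x + δ) then 1 else 0) -
      (∫ u, g u * if frac u < frac x then 1 else 0) =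
      (∫ u, g (u + x) * arcInd δ u) - (∫ u, g u) * w := by
    have : ∫ u, g (u + x) * arcInd δ u = ∫ u, g u * arcInd δ (u - x) := by
      simpa using integral_add_right_eq_self (μ := volume) (fun u => g u * arcInd δ (u - x)) x
    rw [this, ← integral_sub (hgk _) (hgk _), ← integral_mul_const,
      ← integral_sub hga (hg.mul_const _)]
    congr 1 with u
    rw [← mul_sub, step_increment hδ, mul_sub]
  have e2 : (∑' y : J, jump f y * if (y : ℝ) < frac (x + δ) then 1 else 0) -
      (∑' y : J, jump f y * if (y : ℝ) < frac x then 1 else 0) =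
      (∑' y : J, jump f y * arcInd δ ((y : ℝ) - x)) - (∑' y : J, jump f y) * w := by
    rw [← (hstep _).tsum_sub (hstep _), ← tsum_mul_right,
      ← (hsk _ fun y => abs_arcInd_le δ _).tsum_sub (hJs.mul_right w)]
    refine tsum_congr fun y => ?_
    have hy : frac ((y : ℝ) : UnitAddCircle) = y := by
      rw [frac_coe]; exact Int.fract_eq_self.2 y.2.1
    have := step_increment hδ ((y : ℝ) : UnitAddCircle) x
    rw [hy] at this
    rw [← mul_sub, this, mul_sub]
  rw [hfc, hfc x, hind (k := fun y => if y < frac (x + δ) then 1 else 0),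
    hind (k := fun y => if y < frac x then 1 else 0)]
  rw [hJt] at e2
  rw [hgi] at e1
  linarith

end Increment

/-! ### The mean ergodic theorem in `L¹` -/

section MeanErgodic

variable {X : Type*} [MeasurableSpace X] {μ : Measure X} {T : X → X}

theorem coeFn_iterate_compMeasurePreserving (hT : MeasurePreserving T μ μ) (v : Lp ℝ 2 μ) (n : ℕ) :
    ((Lp.compMeasurePreservingₗᵢ ℝ T hT)^[n] v : Lp ℝ 2 μ) =ᵐ[μ] v ∘ T^[n] := by
  induction n with
  | zero => rfl
  | succ n ih =>
    rw [Function.iterate_succ_apply', Function.iterate_succ, ← Function.comp_assoc]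
    exact (Lp.coeFn_compMeasurePreserving _ hT).trans (hT.quasiMeasurePreserving.ae_eq_comp ih)

theorem coeFn_birkhoffAverage_compMeasurePreserving (hT : MeasurePreserving T μ μ) (v : Lp ℝ 2 μ)
    (n : ℕ) : (birkhoffAverage ℝ (Lp.compMeasurePreservingₗᵢ ℝ T hT) id n v : Lp ℝ 2 μ) =ᵐ[μ]
      birkhoffAverage ℝ T v n := by
  have h1 : ∀ s : Finset ℕ, ((∑ k ∈ s, (Lp.compMeasurePreservingₗᵢ ℝ T hT)^[k] v : Lp ℝ 2 μ) :
      X → ℝ) =ᵐ[μ] fun x => ∑ k ∈ s, v (T^[k] x) := by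
    intro s
    induction s using Finset.induction_on with
    | empty => simp only [Finset.sum_empty]; exact Lp.coeFn_zero ℝ 2 μ
    | insert k s hk ih =>
      rw [Finset.sum_insert hk]
      filter_upwards [Lp.coeFn_add ((Lp.compMeasurePreservingₗᵢ ℝ T hT)^[k] v)
        (∑ k ∈ s, (Lp.compMeasurePreservingₗᵢ ℝ T hT)^[k] v), ih,
        coeFn_iterate_compMeasurePreserving hT v k] with x h1 h2 h3
      rw [h1, Pi.add_apply, h2, h3, Finset.sum_insert hk, Function.comp_apply]
  simp only [birkhoffAverage, birkhoffSum, id]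
  filter_upwards [Lp.coeFn_smul ((n : ℝ)⁻¹)
    (∑ k ∈ Finset.range n, (Lp.compMeasurePreservingₗᵢ ℝ T hT)^[k] v), h1 (Finset.range n)]
    with x hx1 hx2
  rw [hx1, Pi.smul_apply, hx2]
  rfl

variable [IsProbabilityMeasure μ]

/-- Von Neumann's theorem gives convergence to the projection onto invariant functions. These are
constants by ergodicity, and pairing with `1` identifies the constant as the integral. -/
theorem tendsto_birkhoffAverage_compMeasurePreserving (hT : Ergodic T μ) (v : Lp ℝ 2 μ) :
    Tendsto (fun n => birkhoffAverage ℝ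
      (Lp.compMeasurePreservingₗᵢ ℝ T hT.toMeasurePreserving) id n v) atTop
      (𝓝 (Lp.const 2 μ (∫ x, v x ∂μ))) := by
  set κ : Lp ℝ 2 μ →L[ℝ] Lp ℝ 2 μ :=
    (Lp.compMeasurePreservingₗᵢ ℝ T hT.toMeasurePreserving).toContinuousLinearMap
  have h := κ.tendsto_birkhoffAverage_orthogonalProjection
    (LinearIsometry.norm_toContinuousLinearMap_le _) v
  set w := (κ.eqLocus (1 : Lp ℝ 2 μ →L[ℝ] Lp ℝ 2 μ)).orthogonalProjectionOnto v
  have hw : κ w = w := w.2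
  obtain ⟨c, hc⟩ := hT.eq_const_of_compMeasurePreserving_eq (g := (w : Lp ℝ 2 μ).1)
    (congrArg Subtype.val hw)
  have hwc : (w : Lp ℝ 2 μ) = Lp.const 2 μ c := Subtype.ext hc
  have hone : κ (Lp.const 2 μ 1) = Lp.const 2 μ 1 := by
    apply Subtype.ext
    rfl
  have hinner (u : Lp ℝ 2 μ) : inner ℝ (Lp.const 2 μ (1 : ℝ)) u = ∫ x, u x ∂μ := by
    rw [L2.inner_def]
    refine integral_congr_ae ?_
    filter_upwards [Lp.coeFn_const 2 μ (1 : ℝ)] with x hx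
    rw [hx]; simp
  have e : inner ℝ (Lp.const 2 μ (1 : ℝ)) (w : Lp ℝ 2 μ) = inner ℝ (Lp.const 2 μ (1 : ℝ)) v :=
    Submodule.inner_orthogonalProjectionOnto_eq_of_mem_left
      (K := κ.eqLocus (1 : Lp ℝ 2 μ →L[ℝ] Lp ℝ 2 μ)) ⟨_, hone⟩ v
  rw [hinner, hinner, hwc] at e
  have : ∫ x, (Lp.const 2 μ c : Lp ℝ 2 μ) x ∂μ = c := by
    rw [integral_congr_ae (Lp.coeFn_const 2 μ c)]
    simp
  rw [this] at e
  rw [← e, ← hwc]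
  exact h

/-- The `L²` case passes to `L¹` by approximation with simple functions, because Birkhoff averages
and integration are both contractions in `L¹`. -/
theorem tendsto_eLpNorm_birkhoffAverage (hT : Ergodic T μ) {g : X → ℝ} (hg : Integrable g μ) :
    Tendsto (fun n => eLpNorm (fun x => birkhoffAverage ℝ T g n x - ∫ y, g y ∂μ) 1 μ) atTop
      (𝓝 0) := by
  have hTm := hT.toMeasurePreserving
  have hbirk {h : X → ℝ} (hh : AEStronglyMeasurable h μ) (n : ℕ) :
      AEStronglyMeasurable (birkhoffAverage ℝ T h n) μ := by
    have : AEStronglyMeasurable (fun x => ∑ k ∈ Finset.range n, h (T^[k] x)) μ :=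
      Finset.aestronglyMeasurable_fun_sum _ fun k _ => hh.comp_measurePreserving (hTm.iterate k)
    exact this.const_smul ((n : ℝ)⁻¹)
  have hL2 {h : X → ℝ} (hh : MemLp h 2 μ) :
      Tendsto (fun n => eLpNorm (fun x => birkhoffAverage ℝ T h n x - ∫ y, h y ∂μ) 1 μ) atTop
        (𝓝 0) := by
    have h1 := tendsto_birkhoffAverage_compMeasurePreserving hT (hh.toLp h)
    rw [Lp.tendsto_Lp_iff_tendsto_eLpNorm'] at h1
    refine tendsto_of_tendsto_of_tendsto_of_le_of_le tendsto_const_nhds h1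
      (fun _ => zero_le) fun n => ?_
    have hae : (fun x => birkhoffAverage ℝ T h n x - ∫ y, h y ∂μ) =ᵐ[μ]
        (birkhoffAverage ℝ (Lp.compMeasurePreservingₗᵢ ℝ T hTm) id n (hh.toLp h) : Lp ℝ 2 μ) -
          (Lp.const 2 μ (∫ x, hh.toLp h x ∂μ) : Lp ℝ 2 μ) := by
      have hk (k : ℕ) := (hTm.iterate k).quasiMeasurePreserving.ae hh.coeFn_toLp
      filter_upwards [coeFn_birkhoffAverage_compMeasurePreserving hTm (hh.toLp h) n,
        Lp.coeFn_const 2 μ (∫ x, hh.toLp h x ∂μ), ae_all_iff.2 hk] with x h1 h2 h3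
      rw [Pi.sub_apply, h1, h2, Function.const_apply, integral_congr_ae hh.coeFn_toLp]
      simp only [birkhoffAverage, birkhoffSum, h3]
    rw [eLpNorm_congr_ae hae]
    exact eLpNorm_le_eLpNorm_of_exponent_le (by norm_num)
      ((Lp.aestronglyMeasurable _).sub (Lp.aestronglyMeasurable _))
  rw [ENNReal.tendsto_atTop_zero]
  intro ε hε
  have hε3 : ε / 3 ≠ 0 := by simp [hε.ne']
  obtain ⟨s, hs, hs2, hsi⟩ : ∃ s : X → ℝ, eLpNorm (g - s) 1 μ < ε / 3 ∧ MemLp s 2 μ ∧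
      Integrable s μ := by
    obtain ⟨s, hs, hsm⟩ := (memLp_one_iff_integrable.2 hg).exists_simpleFunc_eLpNorm_sub_lt
      ENNReal.one_ne_top hε3
    exact ⟨s, hs, s.memLp_of_isFiniteMeasure 2 μ, memLp_one_iff_integrable.1 hsm⟩
  obtain ⟨N, hN⟩ := ENNReal.tendsto_atTop_zero.1 (hL2 hs2) (ε / 3) (pos_iff_ne_zero.2 hε3)
  refine ⟨N, fun n hn => ?_⟩
  have e : (fun x => birkhoffAverage ℝ T g n x - ∫ y, g y ∂μ) =
      (birkhoffAverage ℝ T (g - s) n + fun x => birkhoffAverage ℝ T s n x - ∫ y, s y ∂μ) +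
        fun _ => ∫ y, s y ∂μ - ∫ y, g y ∂μ := by
    ext x
    simp only [Pi.add_apply, birkhoffAverage, birkhoffSum, Pi.sub_apply, Finset.sum_sub_distrib,
      smul_sub]
    ring
  have b1 : eLpNorm (birkhoffAverage ℝ T (g - s) n) 1 μ ≤ ε / 3 := by
    refine le_trans ?_ hs.le
    have hgs : AEStronglyMeasurable (g - s) μ := hg.1.sub hsi.1
    rcases Nat.eq_zero_or_pos n with rfl | hn0
    · simp
    have : birkhoffAverage ℝ T (g - s) n =
        (n : ℝ)⁻¹ • ∑ k ∈ Finset.range n, (g - s) ∘ T^[k] := by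
      ext x; simp [birkhoffAverage, birkhoffSum]
    rw [this, eLpNorm_const_smul]
    calc ‖(n : ℝ)⁻¹‖ₑ * eLpNorm (∑ k ∈ Finset.range n, (g - s) ∘ T^[k]) 1 μ
        ≤ ‖(n : ℝ)⁻¹‖ₑ * ∑ k ∈ Finset.range n, eLpNorm ((g - s) ∘ T^[k]) 1 μ := by
          gcongr
          exact eLpNorm_sum_le (fun k _ => hgs.comp_measurePreserving (hTm.iterate k)) le_rfl
      _ = eLpNorm (g - s) 1 μ := by
          simp_rw [eLpNorm_comp_measurePreserving hgs (hTm.iterate _)]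
          rw [Finset.sum_const, Finset.card_range, nsmul_eq_mul, ← mul_assoc,
            enorm_inv (by positivity), Real.enorm_natCast,
            ENNReal.inv_mul_cancel (by positivity) (by simp), one_mul]
  have b3 : eLpNorm (fun _ : X => ∫ y, s y ∂μ - ∫ y, g y ∂μ) 1 μ ≤ ε / 3 := by
    refine le_trans ?_ hs.le
    rw [eLpNorm_const _ one_ne_zero (NeZero.ne μ), measure_univ, ENNReal.one_rpow, mul_one,
      ← integral_sub hsi hg, ← enorm_neg, ← integral_neg, eLpNorm_one_eq_lintegral_enorm]
    refine (enorm_integral_le_lintegral_enorm _).trans_eq ?_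
    simp
  rw [e]
  calc _ ≤ ε / 3 + ε / 3 + ε / 3 := by
        refine (eLpNorm_add_le ((hbirk (hg.1.sub hsi.1) n).add
          ((hbirk hsi.1 n).sub aestronglyMeasurable_const)) aestronglyMeasurable_const le_rfl).trans
          (add_le_add ?_ b3)
        exact (eLpNorm_add_le (hbirk (hg.1.sub hsi.1) n)
          ((hbirk hsi.1 n).sub aestronglyMeasurable_const) le_rfl).trans (add_le_add b1 (hN n hn))
    _ = ε := ENNReal.add_thirds ε

end MeanErgodic

/-! ### Three estimates for increments of orbit sums -/

section Increments

/-- The increment over `[x, x + δ]` of the sum of `f` along an orbit segment of length `q` of the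
rotation by `β`. -/
def orbitIncrement (f : UnitAddCircle → ℝ) (β : UnitAddCircle) (q : ℕ) (δ : ℝ)
    (x : UnitAddCircle) : ℝ :=
  ∑ k ∈ Finset.range q, (f (x + k • β + δ) - f (x + k • β))

theorem measurePreserving_const_sub_add (v w : UnitAddCircle) :
    MeasurePreserving (fun x : UnitAddCircle => v - (x + w)) := by
  exact (Measure.measurePreserving_sub_left volume v).comp (measurePreserving_add_right volume w)

/-- Union bound: for a nonzero sum, one of `q * s.card` arcs of length `δ` must be hit. The sizes of
the jumps play no role. -/
theorem volume_main_jumps_le {ι : Type*} (s : Finset ι) (d : ι → ℝ) (y : ι → UnitAddCircle)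
    (β : UnitAddCircle) (q : ℕ) {δ : ℝ} (hδ : δ ≤ 1) :
    volume {x | ∑ k ∈ Finset.range q, ∑ i ∈ s, d i * arcInd δ (y i - (x + k • β)) ≠ 0} ≤
      q * (s.card * ENNReal.ofReal δ) := by
  have hsub : {x | ∑ k ∈ Finset.range q, ∑ i ∈ s, d i * arcInd δ (y i - (x + k • β)) ≠ 0} ⊆
      ⋃ k ∈ Finset.range q, ⋃ i ∈ s, {x | frac (y i - (x + k • β)) < δ} := by
    intro x hx
    obtain ⟨k, hk, hk'⟩ := Finset.exists_ne_zero_of_sum_ne_zero hx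
    obtain ⟨i, hi, hi'⟩ := Finset.exists_ne_zero_of_sum_ne_zero hk'
    simp only [mem_iUnion]
    refine ⟨k, hk, i, hi, ?_⟩
    by_contra h
    exact hi' (by simp [arcInd, show ¬ frac (y i - (x + k • β)) < δ from h])
  refine (measure_mono hsub).trans ((measure_biUnion_finset_le _ _).trans ?_)
  calc _ ≤ ∑ k ∈ Finset.range q, (s.card * ENNReal.ofReal δ) := by
        refine Finset.sum_le_sum fun k _ => (measure_biUnion_finset_le _ _).trans ?_
        rw [← nsmul_eq_mul, ← Finset.sum_const]
        refine Finset.sum_le_sum fun i _ => ?_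
        rw [← volume_arc hδ, ← (measurePreserving_const_sub_add (y i)
          (k • β)).measure_preimage
          (measurableSet_lt measurable_frac measurable_const).nullMeasurableSet]
        rfl
    _ = _ := by rw [Finset.sum_const, Finset.card_range, nsmul_eq_mul]

/-- Markov's inequality: each jump contributes `‖d i‖ₑ * δ` to the `L¹` norm at each of the `q`
times. -/
theorem mul_volume_tail_jumps_le {ι : Type*} [Countable ι] (d : ι → ℝ) (y : ι → UnitAddCircle)
    (β : UnitAddCircle) (q : ℕ) {δ : ℝ} (hδ : δ ≤ 1) (θ : ENNReal) :
    θ * volume {x |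
      θ ≤ ‖∑ k ∈ Finset.range q, ∑' i, d i * arcInd δ (y i - (x + k • β))‖ₑ} ≤
      q * ((∑' i, ‖d i‖ₑ) * ENNReal.ofReal δ) := by
  have hm (i : ι) (k : ℕ) : Measurable fun x => ‖d i * arcInd δ (y i - (x + k • β))‖ₑ :=
    (((measurable_arcInd δ).comp (measurePreserving_const_sub_add _ _).measurable).const_mul
      _).enorm
  calc _ ≤ θ * volume {x |
          θ ≤ ∑ k ∈ Finset.range q, ∑' i, ‖d i * arcInd δ (y i - (x + k • β))‖ₑ} := by
        gcongr with x
        exact (enorm_sum_le _ _).trans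
          (Finset.sum_le_sum fun k _ => enorm_tsum_le_tsum_enorm)
    _ ≤ ∫⁻ x, ∑ k ∈ Finset.range q, ∑' i, ‖d i * arcInd δ (y i - (x + k • β))‖ₑ :=
        mul_meas_ge_le_lintegral
          (Finset.measurable_fun_sum _ fun k _ => Measurable.tsum fun i => hm i k) θ
    _ = ∑ k ∈ Finset.range q, ∑' i, ‖d i‖ₑ * ENNReal.ofReal δ := by
        rw [lintegral_finsetSum _ fun k _ => Measurable.tsum fun i => hm i k]
        refine Finset.sum_congr rfl fun k _ => ?_
        rw [lintegral_tsum fun i => (hm i k).aemeasurable]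
        refine tsum_congr fun i => ?_
        simp_rw [enorm_mul]
        rw [lintegral_const_mul' _ _ enorm_ne_top, ← lintegral_enorm_arcInd hδ,
          ← (measurePreserving_const_sub_add (y i) (k • β)).lintegral_comp
            (measurable_arcInd δ).enorm]
    _ = _ := by rw [ENNReal.tsum_mul_right, Finset.sum_const, Finset.card_range, nsmul_eq_mul]

/-- The deviation is `q` times the integral over an arc of the translated ergodic error. Fubini
bounds its `L¹` norm by `q * δ` times that of the error, and Markov's inequality concludes. -/
theorem mul_volume_continuous_part_le {g : UnitAddCircle → ℝ} (hgm : Measurable g)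
    (hg : Integrable g) (β : UnitAddCircle) {q : ℕ} (hq : q ≠ 0) {δ : ℝ} (h0 : 0 ≤ δ)
    (hδ : δ ≤ 1) (θ : ENNReal) :
    θ * volume {x | θ ≤ ‖∑ k ∈ Finset.range q, (∫ u, g (u + (x + k • β)) * arcInd δ u) -
        (∫ u, g u) * (q * δ)‖ₑ} ≤
      q * (ENNReal.ofReal δ *
        eLpNorm (fun x => birkhoffAverage ℝ (· + β) g q x - ∫ y, g y) 1 volume) := by
  set c := ∫ u, g u
  set D : UnitAddCircle → ℝ := fun x => birkhoffAverage ℝ (· + β) g q x - c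
  have hit (k : ℕ) (x : UnitAddCircle) : (· + β)^[k] x = x + k • β := by
    rw [add_right_iterate_apply]
  have hDm : Measurable D := by
    refine Measurable.sub_const (Measurable.const_smul
      (Finset.measurable_fun_sum _ fun k _ => ?_) ((q : ℝ)⁻¹)) c
    simp_rw [hit]
    exact hgm.comp (measurable_add_const _)
  have hint (x : UnitAddCircle) : Integrable fun u => g (u + x) * arcInd δ u :=
    (hg.comp_add_right x).mul_bdd (c := 1) (measurable_arcInd δ).aestronglyMeasurable
      (Eventually.of_forall fun u => abs_arcInd_le δ u)
  have hia : Integrable (arcInd δ) := (integrable_const (1 : ℝ)).mono'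
    (measurable_arcInd δ).aestronglyMeasurable (Eventually.of_forall fun u => abs_arcInd_le δ u)
  have key (x : UnitAddCircle) : ∑ k ∈ Finset.range q, (∫ u, g (u + (x + k • β)) * arcInd δ u) -
      c * (q * δ) = ∫ u, q * (D (u + x) * arcInd δ u) := by
    rw [← integral_finsetSum _ fun k _ => hint _]
    have e : c * (q * δ) = ∫ u, c * (q * arcInd δ u) := by
      rw [integral_const_mul, integral_const_mul, integral_arcInd h0 hδ]
    rw [e, ← integral_sub (integrable_finsetSum _ fun k _ => hint _)
        ((hia.const_mul _).const_mul _)]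
    congr 1 with u
    simp only [D, birkhoffAverage, birkhoffSum, hit, smul_eq_mul, ← Finset.sum_mul, add_assoc]
    field_simp
  have hm2 : Measurable fun p : UnitAddCircle × UnitAddCircle =>
      ‖D (p.2 + p.1)‖ₑ * ‖arcInd δ p.2‖ₑ :=
    (hDm.comp (measurable_snd.add measurable_fst)).enorm.mul
      ((measurable_arcInd δ).comp measurable_snd).enorm
  calc _ ≤ θ * volume {x | θ ≤ q * ∫⁻ u, ‖D (u + x)‖ₑ * ‖arcInd δ u‖ₑ} := by
        gcongr with x
        rw [key, integral_const_mul, enorm_mul, Real.enorm_natCast]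
        gcongr
        refine (enorm_integral_le_lintegral_enorm _).trans_eq ?_
        simp_rw [enorm_mul]
    _ ≤ ∫⁻ x, q * ∫⁻ u, ‖D (u + x)‖ₑ * ‖arcInd δ u‖ₑ :=
        mul_meas_ge_le_lintegral (hm2.lintegral_prod_right'.const_mul _) θ
    _ = q * ∫⁻ u, ∫⁻ x, ‖D (u + x)‖ₑ * ‖arcInd δ u‖ₑ := by
        rw [lintegral_const_mul' _ _ (by simp), lintegral_lintegral_swap hm2.aemeasurable]
    _ = _ := by
        congr 1
        rw [eLpNorm_one_eq_lintegral_enorm, ← lintegral_enorm_arcInd hδ,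
          ← lintegral_mul_const _ (measurable_arcInd δ).enorm]
        refine lintegral_congr fun u => ?_
        rw [lintegral_mul_const' _ _ enorm_ne_top, mul_comm,
          lintegral_add_left_eq_self (fun x => ‖D x‖ₑ) u]

end Increments

/-! ### Concentration of increments at scale `a / q` -/

section Rotation

instance : IsProbabilityMeasure (volume : Measure UnitAddCircle) :=
  ⟨UnitAddCircle.measure_univ⟩

theorem addOrderOf_coe_eq_zero {α : ℝ} (hα : Irrational α) :
    addOrderOf (α : UnitAddCircle) = 0 := by
  rw [addOrderOf_eq_zero_iff']
  intro n hn h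
  rw [← AddCircle.coe_nsmul, AddCircle.coe_eq_zero_iff] at h
  obtain ⟨m, hm⟩ := h
  refine (hα.natCast_mul hn.ne').ne_int m ?_
  simpa using hm.symm

theorem ergodic_rotation {α : ℝ} (hα : Irrational α) :
    Ergodic fun x : UnitAddCircle => x + (α : UnitAddCircle) :=
  AddCircle.ergodic_add_right.2 (addOrderOf_coe_eq_zero hα)

/-- At the scale `a / q`, the increments of the sum of `f` along orbit segments of length `q` are
close to `-jumpSum f * a` with probability close to one. -/
theorem eventually_volume_orbitIncrement_le {α : ℝ} (hα : Irrational α) {f : UnitAddCircle → ℝ}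
    (hf : IsBVaj f) (hS : jumpSum f ≠ 0) {ε : ℝ} (hε : 0 < ε) :
    ∃ K : ℕ, ∀ a ∈ Ioo (0 : ℝ) 1, ∀ᶠ q : ℕ in atTop,
      volume {x | |jumpSum f| * a / 2 ≤ |orbitIncrement f α q (a / q) x + jumpSum f * a|} ≤
        K * ENNReal.ofReal a + ENNReal.ofReal ε := by
  obtain ⟨g, J, d, hJ, hgm, hg, hgi, hd, hinc⟩ := hf.exists_increment hS
  set S := jumpSum f
  have hSpos : 0 < |S| := abs_pos.2 hS
  have : Countable J := hJ
  -- Since `q * δ = a`, the ergodic error and the tail jumps each have `L¹` norm at most `a *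
  -- (ε|S|/8)`. Markov's inequality at the level `θ = |S|a/4` then yields `ε/2` for each.
  have hη : 0 < ENNReal.ofReal (ε * |S| / 8) := ENNReal.ofReal_pos.2 (by positivity)
  have hdn : ∑' i, ‖d i‖ₑ ≠ ⊤ := by
    simp_rw [← ofReal_norm]
    exact hd.norm.tsum_ofReal_ne_top
  obtain ⟨s, hs⟩ := ((ENNReal.tendsto_tsum_compl_atTop_zero hdn).eventually_le_const hη).exists
  -- The set `s` of main jumps depends on `ε` only, so the constant `K` is fixed before `a`.
  refine ⟨s.card, fun a ha => ?_⟩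
  have hbirk := (tendsto_eLpNorm_birkhoffAverage (ergodic_rotation hα) hg).eventually_le_const hη
  filter_upwards [hbirk, eventually_ge_atTop 2] with q hq hq2
  have hq0 : (0 : ℝ) < q := by positivity
  have hδ : a / q ∈ Ioo (0 : ℝ) 1 := by
    refine ⟨div_pos ha.1 hq0, (div_lt_one hq0).2 (ha.2.trans ?_)⟩
    exact_mod_cast hq2
  set δ := a / q with hδdef
  have hqδ : q * δ = a := by rw [hδdef]; field_simp
  have hqδ' : (q : ENNReal) * ENNReal.ofReal δ = ENNReal.ofReal a := by
    rw [← ENNReal.ofReal_natCast, ← ENNReal.ofReal_mul hq0.le, hqδ]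
  set y : J → UnitAddCircle := fun i => ((i : ℝ) : UnitAddCircle)
  set θ := ENNReal.ofReal (|S| * a / 4) with hθ
  have hθ0 : θ ≠ 0 := (ENNReal.ofReal_pos.2 (by have := ha.1; positivity)).ne'
  have hθε : ENNReal.ofReal a * ENNReal.ofReal (ε * |S| / 8) = θ * ENNReal.ofReal (ε / 2) := by
    rw [hθ, ← ENNReal.ofReal_mul ha.1.le, ← ENNReal.ofReal_mul (by have := ha.1; positivity)]
    congr 1; ring
  have cancel {r : ENNReal} (h : θ * r ≤ ENNReal.ofReal a * ENNReal.ofReal (ε * |S| / 8)) :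
      r ≤ ENNReal.ofReal (ε / 2) := by
    rw [hθε] at h
    exact (ENNReal.mul_le_mul_iff_right hθ0 ENNReal.ofReal_ne_top).1 h
  have hM := volume_main_jumps_le s d y α q hδ.2.le
  have hA := mul_volume_continuous_part_le hgm hg α (by positivity : q ≠ 0) hδ.1.le hδ.2.le θ
  have hB := mul_volume_tail_jumps_le (fun i : {i // i ∉ s} => d i) (fun i => y i) α q hδ.2.le θ
  set A : UnitAddCircle → ℝ := fun x =>
    ∑ k ∈ Finset.range q, (∫ u, g (u + (x + k • (α : UnitAddCircle))) * arcInd δ u) -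
      (∫ u, g u) * (q * δ)
  set M : UnitAddCircle → ℝ := fun x =>
    ∑ k ∈ Finset.range q, ∑ i ∈ s, d i * arcInd δ (y i - (x + k • (α : UnitAddCircle)))
  set B : UnitAddCircle → ℝ := fun x => ∑ k ∈ Finset.range q,
    ∑' i : {i // i ∉ s}, d i * arcInd δ (y i - (x + k • (α : UnitAddCircle)))
  have hsum (x : UnitAddCircle) : orbitIncrement f α q δ x + S * a = A x + (M x + B x) := by
    have h1 (x : UnitAddCircle) : f (x + δ) - f x = (∫ u, g (u + x) * arcInd δ u) +
        (∑ i ∈ s, d i * arcInd δ (y i - x) +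
          ∑' i : {i // i ∉ s}, d i * arcInd δ (y i - x)) := by
      have hsm : Summable fun i => d i * arcInd δ (y i - x) := by
        refine Summable.of_norm_bounded hd.abs fun i => ?_
        rw [norm_mul]
        exact mul_le_of_le_one_right (abs_nonneg _) (abs_arcInd_le δ _)
      rw [hinc δ hδ x, ← hsm.sum_add_tsum_subtype_compl s]
    simp only [orbitIncrement, h1, Finset.sum_add_distrib, A, M, B, hqδ, hgi]
    ring
  have hsub : {x | |S| * a / 2 ≤ |orbitIncrement f α q δ x + S * a|} ⊆
      {x | M x ≠ 0} ∪ ({x | θ ≤ ‖A x‖ₑ} ∪ {x | θ ≤ ‖B x‖ₑ}) := by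
    intro x hx
    rw [mem_ofPred_eq, hsum] at hx
    by_contra hcon
    simp only [mem_union, mem_ofPred_eq, not_or, not_not, not_le, hθ,
      Real.enorm_eq_ofReal_abs] at hcon
    obtain ⟨h1, h2, h3⟩ := hcon
    have h2' := (ENNReal.ofReal_lt_ofReal_iff_of_nonneg (abs_nonneg _)).1 h2
    have h3' := (ENNReal.ofReal_lt_ofReal_iff_of_nonneg (abs_nonneg _)).1 h3
    rw [h1, zero_add] at hx
    linarith [abs_add_le (A x) (B x)]
  calc _ ≤ volume {x | M x ≠ 0} + (volume {x | θ ≤ ‖A x‖ₑ} + volume {x | θ ≤ ‖B x‖ₑ}) :=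
        (measure_mono hsub).trans ((measure_union_le _ _).trans
          (add_le_add_right (measure_union_le _ _) _))
    _ ≤ s.card * ENNReal.ofReal a + (ENNReal.ofReal (ε / 2) + ENNReal.ofReal (ε / 2)) := by
        refine add_le_add ?_ (add_le_add (cancel ?_) (cancel ?_))
        · rw [← hqδ', mul_left_comm]; exact hM
        · refine hA.trans ?_
          rw [← mul_assoc, hqδ']
          gcongr
        · refine hB.trans ?_
          rw [mul_left_comm, hqδ', mul_comm]
          gcongr
    _ = _ := by rw [← ENNReal.ofReal_add (by positivity) (by positivity), add_halves]

end Rotation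

/-! ### Small periods of solutions of the cocycle equation -/

section Rigidity

theorem tendsto_lintegral_translate {H G : Type*} [NormedAddCommGroup H] [AddCommGroup G]
    [TopologicalSpace G] [IsTopologicalAddGroup G] [MeasurableSpace G] [BorelSpace G]
    {μ : Measure G} [IsLocallyFiniteMeasure μ] [μ.InnerRegularCompactLTTop] [μ.IsAddLeftInvariant]
    {φ : G → H} (hφ : MemLp φ 1 μ) :
    Tendsto (fun v : G => ∫⁻ x, ‖φ (x + v) - φ x‖ₑ ∂μ) (𝓝 0) (𝓝 0) := by
  have : Fact ((1 : ENNReal) ≠ ⊤) := ⟨ENNReal.one_ne_top⟩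
  have hc : Continuous fun v : G => DomAddAct.mk v +ᵥ hφ.toLp :=
    DomAddAct.continuous_mk.vadd continuous_const
  have h := hc.tendsto 0
  rw [Lp.tendsto_Lp_iff_tendsto_eLpNorm'] at h
  refine h.congr fun v => ?_
  rw [eLpNorm_one_eq_lintegral_enorm]
  refine lintegral_congr_ae ?_
  rw [DomAddAct.mk_vadd_toLp, DomAddAct.mk_vadd_toLp]
  filter_upwards [MemLp.coeFn_toLp (hφ.comp_measurePreserving (measurePreserving_vadd v μ)),
    MemLp.coeFn_toLp (hφ.comp_measurePreserving (measurePreserving_vadd (0 : G) μ))] with x h1 h2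
  refine (congrArg enorm (congrArg₂ (· - ·) h1 h2)).trans ?_
  simp [add_comm]

variable {H : Type*} [NormedAddCommGroup H] [NormedSpace ℝ H] {U : ℝ → H →ₗᵢ[ℝ] H}

theorem ae_eq_iterate {f : UnitAddCircle → ℝ} {φ : UnitAddCircle → H} {β : UnitAddCircle}
    (hU : IsIsometricAction U) (hφ : ∀ᵐ x, φ x = U (f x) (φ (x + β))) :
    ∀ᵐ x, ∀ q : ℕ, φ x = U (∑ k ∈ Finset.range q, f (x + k • β)) (φ (x + q • β)) := by
  have h (k : ℕ) := (measurePreserving_add_right volume (k • β)).quasiMeasurePreserving.ae hφ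
  filter_upwards [ae_all_iff.2 h] with x hx q
  induction q with
  | zero => simp [hU.map_zero]
  | succ q ih =>
    rw [Finset.sum_range_succ, hU.map_add, succ_nsmul, ← add_assoc, ← hx q, ← ih]

/-- Meant for `u, v = φ(x), φ(x + δ)`, with `u', v'` their values after `q` steps and `F, G` the
orbit sums. Here `U (G - F) u = U G u'` and `U G v' = v`, and the chain `u'`, `u`, `v`, `v'` is
compared under the isometry `U G`. -/
theorem norm_increment_le {F G : ℝ} {u u' v v' : H} (hU : IsIsometricAction U)
    (h1 : u = U F u') (h2 : v = U G v') :
    ‖U (G - F) u - u‖ ≤ ‖u' - u‖ + ‖v' - v‖ + 2 * ‖v - u‖ := by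
  have e1 : U (G - F) u = U G u' := by
    rw [sub_eq_add_neg, hU.map_add, h1, hU.neg_apply_apply]
  have e2 : U G u' - u = U G (u' - u) + U G (u - v) + U G (v - v') + (v - u) := by
    simp only [map_sub]
    rw [← h2]; abel
  rw [e1, e2]
  calc _ ≤ ‖U G (u' - u)‖ + ‖U G (u - v)‖ + ‖U G (v - v')‖ + ‖v - u‖ :=
        norm_add_le_of_le (norm_add₃_le) le_rfl
    _ = _ := by
        simp only [LinearIsometry.norm_map]
        rw [norm_sub_rev u v, norm_sub_rev v v']
        ring

/-- Isometry makes `‖φ‖` invariant under the rotation, hence a.e. constant. -/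
theorem exists_memLp_of_cocycle {α : ℝ} (hα : Irrational α) {f : UnitAddCircle → ℝ}
    {φ : UnitAddCircle → H} (hφm : StronglyMeasurable φ)
    (hφ : ∀ᵐ x, φ x = U (f x) (φ (x + (α : UnitAddCircle)))) : MemLp φ 1 := by
  obtain ⟨C, hC⟩ := (ergodic_rotation hα).ae_eq_const_of_ae_eq_comp_ae
    (g := fun x => ‖φ x‖) hφm.norm.aestronglyMeasurable <| by
      filter_upwards [hφ] with x hx
      rw [Function.comp_apply, hx, LinearIsometry.norm_map]
  exact MemLp.of_bound hφm.aestronglyMeasurable C (hC.mono fun x hx => hx.le)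

theorem exists_tendsto_nsmul (β : UnitAddCircle) :
    ∃ q : ℕ → ℕ, StrictMono q ∧ Tendsto (fun n => q n • β) atTop (𝓝 0) :=
  (mapClusterPt_zero_atTop_nsmul β).tendsto_subseq

/-- The points `x` for which no `t` close to `-S * a` is nearly a period of `φ x`. -/
def aperiodicSet (U : ℝ → H →ₗᵢ[ℝ] H) (φ : UnitAddCircle → H) (S a r : ℝ) : Set UnitAddCircle :=
  {x | ∀ t, |t + S * a| ≤ |S| * a / 2 → r ≤ ‖U t (φ x) - φ x‖}

/-- Along times `q n` with `q n • α → 0` the orbit increment is an almost period of `φ x`, up to an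
error `E n` that tends to `0` in `L¹` by continuity of translations. -/
theorem volume_aperiodicSet_le {α : ℝ} {f : UnitAddCircle → ℝ}
    {φ : UnitAddCircle → H} (hU : IsIsometricAction U) (hφm : StronglyMeasurable φ)
    (hφ : ∀ᵐ x, φ x = U (f x) (φ (x + (α : UnitAddCircle)))) (hL : MemLp φ 1)
    {S a r : ℝ} (hr : 0 < r) {κ : ENNReal}
    (hκ : ∀ᶠ q : ℕ in atTop,
      volume {x | |S| * a / 2 ≤ |orbitIncrement f α q (a / q) x + S * a|} ≤ κ) :
    volume (aperiodicSet U φ S a r) ≤ κ := by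
  obtain ⟨q, hq, hqα⟩ := exists_tendsto_nsmul (α : UnitAddCircle)
  set δ : ℕ → UnitAddCircle := fun n => ((a / q n : ℝ) : UnitAddCircle)
  have hδ0 : Tendsto δ atTop (𝓝 0) := by
    have h1 : Tendsto (fun n => a / (q n : ℝ)) atTop (𝓝 0) :=
      tendsto_const_nhds.div_atTop (tendsto_natCast_atTop_atTop.comp hq.tendsto_atTop)
    have h2 : Continuous fun t : ℝ => (t : UnitAddCircle) := AddCircle.continuous_mk' 1
    exact (h2.tendsto 0).comp h1
  set τ : UnitAddCircle → ENNReal := fun v => ∫⁻ x, ‖φ (x + v) - φ x‖ₑ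
  have hτ : Tendsto τ (𝓝 0) (𝓝 0) := tendsto_lintegral_translate hL
  set E : ℕ → UnitAddCircle → ENNReal := fun n x =>
    ‖φ (x + q n • (α : UnitAddCircle)) - φ x‖ₑ +
      ‖φ (x + δ n + q n • (α : UnitAddCircle)) - φ (x + δ n)‖ₑ + 2 * ‖φ (x + δ n) - φ x‖ₑ
  have hm (v : UnitAddCircle) : Measurable fun x => ‖φ (x + v) - φ x‖ₑ :=
    ((hφm.comp_measurable (measurable_add_const v)).sub hφm).enorm
  have hm' (v w : UnitAddCircle) : Measurable fun x => ‖φ (x + w + v) - φ (x + w)‖ₑ :=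
    (hm v).comp (measurable_add_const w)
  have hE (n : ℕ) : ∫⁻ x, E n x = 2 * τ (q n • (α : UnitAddCircle)) + 2 * τ (δ n) := by
    simp only [E, τ]
    rw [lintegral_add_right _ ((hm _).const_mul 2), lintegral_add_left (hm _),
      lintegral_const_mul _ (hm _),
      lintegral_add_right_eq_self
        (fun x => ‖φ (x + q n • (α : UnitAddCircle)) - φ x‖ₑ) (δ n)]
    ring
  have hEm (n : ℕ) : Measurable (E n) := ((hm _).add (hm' _ _)).add ((hm _).const_mul 2)
  have hE0 : Tendsto (fun n => ∫⁻ x, E n x) atTop (𝓝 0) := by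
    simp_rw [hE]
    have h1 := ENNReal.Tendsto.const_mul (a := 2) (hτ.comp hqα) (Or.inr (by simp))
    have h2 := ENNReal.Tendsto.const_mul (a := 2) (hτ.comp hδ0) (Or.inr (by simp))
    simpa using h1.add h2
  have hit := ae_eq_iterate hU hφ
  have hbound (n : ℕ) : ∀ᵐ x, ‖U (orbitIncrement f α (q n) (a / q n) x) (φ x) - φ x‖ₑ ≤ E n x := by
    filter_upwards [hit, (measurePreserving_add_right volume (δ n)).quasiMeasurePreserving.ae hit]
      with x h1 h2
    have h3 := norm_increment_le hU (h1 (q n)) (h2 (q n))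
    have h4 : orbitIncrement f α (q n) (a / q n) x =
        ∑ k ∈ Finset.range (q n), f (x + δ n + k • (α : UnitAddCircle)) -
          ∑ k ∈ Finset.range (q n), f (x + k • (α : UnitAddCircle)) := by
      simp only [orbitIncrement, Finset.sum_sub_distrib, add_right_comm, δ]
    rw [h4]
    simp only [E, ← ofReal_norm]
    rw [show (2 : ENNReal) = ENNReal.ofReal 2 by simp, ← ENNReal.ofReal_mul zero_le_two,
      ← ENNReal.ofReal_add (by positivity) (by positivity),
      ← ENNReal.ofReal_add (by positivity) (by positivity)]
    exact ENNReal.ofReal_le_ofReal h3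
  have hlim : Tendsto (fun n => κ + (∫⁻ x, E n x) / ENNReal.ofReal r) atTop (𝓝 κ) := by
    have := ENNReal.Tendsto.div_const hE0 (b := ENNReal.ofReal r)
      (Or.inr (ENNReal.ofReal_pos.2 hr).ne')
    simpa using tendsto_const_nhds.add this
  refine ge_of_tendsto hlim ?_
  filter_upwards [hq.tendsto_atTop.eventually hκ] with n hn
  calc volume (aperiodicSet U φ S a r)
      ≤ volume ({x | |S| * a / 2 ≤ |orbitIncrement f α (q n) (a / q n) x + S * a|} ∪
          {x | ENNReal.ofReal r ≤ E n x}) := by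
        refine measure_mono_ae ?_
        filter_upwards [hbound n] with x hx hxa
        -- Either the increment is far from `-S * a`, or it is an admissible `t` in `aperiodicSet`,
        -- which forces the error to be at least `r`.
        by_cases h : |S| * a / 2 ≤ |orbitIncrement f α (q n) (a / q n) x + S * a|
        · exact Or.inl h
        · right
          refine le_trans ?_ hx
          rw [← ofReal_norm]
          exact ENNReal.ofReal_le_ofReal (hxa _ (not_le.1 h).le)
    _ ≤ κ + (∫⁻ x, E n x) / ENNReal.ofReal r :=
        (measure_union_le _ _).trans (add_le_add hn (meas_ge_le_lintegral_div
          (hEm n).aemeasurable (ENNReal.ofReal_pos.2 hr).ne' ENNReal.ofReal_ne_top))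

theorem ae_fixed_of_cocycle {α : ℝ} (hα : Irrational α) {f : UnitAddCircle → ℝ}
    (hf : IsBVaj f) (hS : jumpSum f ≠ 0) {φ : UnitAddCircle → H} (hU : IsIsometricAction U)
    (hφm : StronglyMeasurable φ)
    (hφ : ∀ᵐ x, φ x = U (f x) (φ (x + (α : UnitAddCircle)))) :
    ∀ᵐ x, ∀ t, U t (φ x) = φ x := by
  set S := jumpSum f
  have hSpos : 0 < |S| := abs_pos.2 hS
  have hL := exists_memLp_of_cocycle hα hφm hφ
  set N : ℝ → Set UnitAddCircle := fun a =>
    {x | ∀ t, |t + S * a| ≤ |S| * a / 2 → U t (φ x) ≠ φ x} with hN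
  -- The admissible `t` form a compact interval, so if none is a period then `‖U t (φ x) - φ x‖` is
  -- bounded away from `0` on it.
  have hNsub (a : ℝ) (ha : 0 < a) : N a ⊆ ⋃ j : ℕ, aperiodicSet U φ S a (1 / (j + 1)) := by
    intro x hx
    have hcomp : IsCompact (Metric.closedBall (-(S * a)) (|S| * a / 2)) :=
      isCompact_closedBall _ _
    obtain ⟨t, ht, hmin⟩ := hcomp.exists_isMinOn
      (Metric.nonempty_closedBall.2 (by positivity))
      (f := fun t => ‖U t (φ x) - φ x‖) ((hU.continuous _).sub continuous_const).norm.continuousOn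
    have hb (s : ℝ) : s ∈ Metric.closedBall (-(S * a)) (|S| * a / 2) ↔
        |s + S * a| ≤ |S| * a / 2 := by
      rw [Metric.mem_closedBall, Real.dist_eq, sub_neg_eq_add]
    have hpos : 0 < ‖U t (φ x) - φ x‖ :=
      norm_pos_iff.2 (sub_ne_zero.2 (hx t ((hb t).1 ht)))
    obtain ⟨j, hj⟩ := exists_nat_one_div_lt hpos
    exact mem_iUnion.2 ⟨j, fun s hs => hj.le.trans (hmin ((hb s).2 hs))⟩
  set a : ℕ → ℝ := fun i => 1 / ((i : ℝ) + 2) with ha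
  have ha0 (i : ℕ) : a i ∈ Ioo (0 : ℝ) 1 := by
    refine ⟨by positivity, ?_⟩
    rw [ha, div_lt_one (by positivity)]
    have : (0 : ℝ) ≤ i := i.cast_nonneg
    linarith
  have hat : Tendsto a atTop (𝓝 0) :=
    tendsto_const_nhds.div_atTop (tendsto_atTop_add_const_right _ _ tendsto_natCast_atTop_atTop)
  have hsub : {x | ¬ ∀ t, U t (φ x) = φ x} ⊆ ⋃ m : ℕ, ⋂ i : ℕ, N (a (m + i)) := by
    intro x hx
    by_contra hcon
    simp only [mem_iUnion, mem_iInter, not_exists, not_forall] at hcon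
    apply hx
    let P : AddSubgroup ℝ :=
      { carrier := {t | U t (φ x) = φ x}
        add_mem' := fun {s t} hs ht => by
          simp only [mem_ofPred_eq] at *
          rw [hU.map_add, ht, hs]
        zero_mem' := hU.map_zero _
        neg_mem' := fun {t} ht => by
          simp only [mem_ofPred_eq] at *
          nth_rw 1 [← ht]
          exact hU.neg_apply_apply t _ }
    have hclosed : IsClosed (P : Set ℝ) := isClosed_eq (hU.continuous _) continuous_const
    have hdense : Dense (P : Set ℝ) := by
      refine P.dense_of_not_isolated_zero fun ε hε => ?_
      have hlim : Tendsto (fun i => 3 / 2 * |S| * a i) atTop (𝓝 0) := by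
        simpa using hat.const_mul (3 / 2 * |S|)
      obtain ⟨m, hm⟩ := eventually_atTop.1 (hlim.eventually (gt_mem_nhds hε))
      obtain ⟨i, hi⟩ := hcon m
      have hmi := hm (m + i) (by omega)
      have hai := (ha0 (m + i)).1
      simp only [hN, mem_ofPred_eq, not_forall, not_not] at hi
      obtain ⟨t, ht, htφ⟩ := hi
      have htP : t ∈ P := htφ
      have hSa : |S * a (m + i)| = |S| * a (m + i) := by rw [abs_mul, abs_of_pos hai]
      have hSpos' := mul_pos hSpos hai
      have ht1 : |t| ≤ 3 / 2 * |S| * a (m + i) := by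
        have := abs_sub_abs_le_abs_sub t (-(S * a (m + i)))
        rw [sub_neg_eq_add, abs_neg, hSa] at this
        linarith
      have ht0 : t ≠ 0 := by
        rintro rfl
        rw [zero_add, hSa] at ht
        linarith
      refine ⟨|t|, ?_, abs_pos.2 ht0, ht1.trans_lt hmi⟩
      rcases abs_choice t with h | h <;> rw [h]
      · exact htP
      · exact P.neg_mem htP
    intro t
    have : t ∈ (P : Set ℝ) := by rw [hclosed.closure_eq.symm, hdense.closure_eq]; trivial
    exact this
  rw [ae_iff]
  refine le_antisymm (ENNReal.le_of_forall_pos_le_add fun ε hε _ => ?_) zero_le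
  rw [zero_add]
  -- With `ε`, hence `K`, fixed, the scale `a` tends to `0` and the term `K * a` disappears.
  obtain ⟨K, hK⟩ := eventually_volume_orbitIncrement_le hα hf hS (ε := ε) hε
  have hNa (i : ℕ) : volume (N (a i)) ≤ K * ENNReal.ofReal (a i) + ENNReal.ofReal ε := by
    refine (measure_mono (hNsub _ (ha0 i).1)).trans ?_
    rw [Monotone.measure_iUnion]
    · exact iSup_le fun j => volume_aperiodicSet_le hU hφm hφ hL (by positivity)
        (hK _ (ha0 i))
    · intro j k hjk x hx t ht
      exact (one_div_le_one_div_of_le (by positivity) (by simpa using hjk)).trans (hx t ht)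
  refine (measure_mono hsub).trans ?_
  rw [Monotone.measure_iUnion]
  · refine iSup_le fun m => ?_
    have hlim : Tendsto (fun i => (K : ENNReal) * ENNReal.ofReal (a (m + i)) + ENNReal.ofReal ε)
        atTop (𝓝 ε) := by
      have h1 : Tendsto (fun i => a (m + i)) atTop (𝓝 0) := by
        simp only [add_comm m]
        exact hat.comp (tendsto_add_atTop_nat m)
      have h2 := ENNReal.Tendsto.const_mul (a := (K : ENNReal))
        (ENNReal.tendsto_ofReal h1) (Or.inr (by simp))
      simpa using h2.add_const (ENNReal.ofReal ε)
    exact ge_of_tendsto hlim (Eventually.of_forall fun i =>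
      (measure_mono (iInter_subset _ i)).trans (hNa _))
  · intro m n hmn x hx
    simp only [mem_iInter] at hx ⊢
    intro i
    have := hx (n - m + i)
    rwa [show m + (n - m + i) = n + i by omega] at this

end Rigidity

/-! ### Regularity of the roof function and existence of passage numbers -/

section Roof

theorem tendsto_atTop_of_frequently_increment {u : ℕ → ℝ} (hu : Monotone u) {c : ℝ} (hc : 0 < c)
    (h : ∃ᶠ n in atTop, c ≤ u (n + 1) - u n) : Tendsto u atTop atTop := by
  rcases tendsto_atTop_of_monotone hu with h1 | ⟨l, hl⟩
  · exact h1
  · have h2 : Tendsto (fun n => u (n + 1) - u n) atTop (𝓝 0) := by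
      simpa using (hl.comp (tendsto_add_atTop_nat 1)).sub hl
    exact absurd h (not_frequently.2 ((h2.eventually_lt_const hc).mono fun n hn => hn.not_ge))

theorem rotation_zpow_apply (α : ℝ) (n : ℤ) (x : UnitAddCircle) :
    (rotation α ^ n) x = x + n • (α : UnitAddCircle) := by
  induction n using Int.induction_on with
  | zero => simp
  | succ n ih =>
    rw [add_comm (n : ℤ) 1, zpow_one_add, Equiv.Perm.mul_apply, ih, add_comm 1 (n : ℤ)]
    simp [rotation, add_zsmul, add_assoc]
  | pred n ih =>
    apply (rotation α).injective
    rw [← Equiv.Perm.mul_apply, ← zpow_one_add, show 1 + (-(n : ℤ) - 1) = -n by ring, ih]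
    simp [rotation, sub_zsmul, add_assoc]

theorem measurePreserving_rotation_zpow (α : ℝ) (n : ℤ) :
    MeasurePreserving (rotation α ^ n) volume volume := by
  have : ⇑(rotation α ^ n) = fun x => x + n • (α : UnitAddCircle) :=
    funext (rotation_zpow_apply α n)
  rw [this]
  exact measurePreserving_add_right volume _

variable {f : UnitAddCircle → ℝ}

theorem IsBV.exists_measurable_bounded (hf : IsBV f) : Measurable f ∧ ∃ C, ∀ x, |f x| ≤ C := by
  obtain ⟨p, q, hp, hq, hpq⟩ :=
    (BoundedVariationOn.locallyBoundedVariationOn hf).exists_monotoneOn_sub_monotoneOn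
  have ext {p : ℝ → ℝ} (hp : MonotoneOn p (Icc 0 1)) : ∃ P, Monotone P ∧ EqOn p P (Icc 0 1) := by
    refine hp.exists_monotone_extension ⟨p 0, ?_⟩ ⟨p 1, ?_⟩
    · rintro _ ⟨x, hx, rfl⟩; exact hp (left_mem_Icc.2 zero_le_one) hx hx.1
    · rintro _ ⟨x, hx, rfl⟩; exact hp hx (right_mem_Icc.2 zero_le_one) hx.2
  obtain ⟨P, hP, hPp⟩ := ext hp
  obtain ⟨Q, hQ, hQq⟩ := ext hq
  have hfz (z : UnitAddCircle) : f z = P (frac z) - Q (frac z) := by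
    have hz : frac z ∈ Icc (0 : ℝ) 1 := ⟨(frac_mem z).1, (frac_mem z).2.le⟩
    rw [← hPp hz, ← hQq hz, ← Pi.sub_apply, ← hpq, lift, coe_frac]
  constructor
  · rw [funext hfz]
    exact (hP.measurable.comp measurable_frac).sub (hQ.measurable.comp measurable_frac)
  · refine ⟨|P 1 - Q 0| + |P 0 - Q 1|, fun z => ?_⟩
    have hz := frac_mem z
    rw [hfz, abs_le]
    have := hP hz.1; have := hP hz.2.le; have := hQ hz.1; have := hQ hz.2.le
    constructor <;> linarith [le_abs_self (P 1 - Q 0), neg_abs_le (P 0 - Q 1),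
      abs_nonneg (P 1 - Q 0), abs_nonneg (P 0 - Q 1)]

/-- A positive left-continuous function may have infimum `0`; a lower bound on one arc ending at `0`
is available and suffices. -/
theorem IsLeftContinuous.exists_lower_bound (hf : IsLeftContinuous f) (hpos : ∀ x, 0 < f x) :
    ∃ c > 0, ∃ V : Set UnitAddCircle, IsOpen V ∧ V.Nonempty ∧ ∀ x ∈ V, c ≤ f x := by
  have h0 : 0 < lift f 0 := hpos _
  have h1 : ∀ᶠ x in 𝓝[≤] (0 : ℝ), lift f 0 / 2 < lift f x :=
    (hf 0).eventually_const_lt (half_lt_self h0)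
  obtain ⟨l, hl, hl'⟩ := (mem_nhdsLE_iff_exists_Ioc_subset).1 h1
  refine ⟨lift f 0 / 2, half_pos h0, (fun t : ℝ => (t : UnitAddCircle)) '' Ioo l 0,
    QuotientAddGroup.isOpenMap_coe _ isOpen_Ioo, (nonempty_Ioo.2 hl).image _, ?_⟩
  rintro _ ⟨t, ht, rfl⟩
  exact (hl' ⟨ht.1, ht.2.le⟩).le

/-- The orbit visits an arc where `f ≥ c` infinitely often in both directions, so the strictly
increasing sequence of cocycle values is unbounded both ways. The passage number is the greatest `n`
with value at most `r`. -/
theorem existsUnique_isPassage {α : ℝ} (hα : Irrational α) (hf : IsLeftContinuous f)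
    (hpos : ∀ x, 0 < f x) (x : UnitAddCircle) (r : ℝ) :
    ∃! n : ℤ, IsPassage (rotation α) f x r n := by
  obtain ⟨c, hc, V, hV, hVne, hVc⟩ := hf.exists_lower_bound hpos
  have hmono := cocycle_strictMono (T := rotation α) hpos x
  obtain ⟨m, hm⟩ : ∃ m : ℤ, x + m • (α : UnitAddCircle) ∈ V := by
    have hd := AddCircle.denseRange_zsmul_coe_iff (p := (1 : ℝ)) (a := α) |>.2 (by simpa)
    obtain ⟨m, hm⟩ := hd.exists_mem_open (hV.preimage (continuous_const_add x))
      (by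
        obtain ⟨v, hv⟩ := hVne
        exact ⟨v - x, by simpa using hv⟩)
    exact ⟨m, hm⟩
  obtain ⟨q, hq, hqα⟩ := exists_tendsto_nsmul (α : UnitAddCircle)
  -- One visit at time `m` yields visits at the times `m + q n` and `m - q n` for large `n`, because
  -- `q n • α → 0`.
  have hV0 : (fun v => x + m • (α : UnitAddCircle) + v) ⁻¹' V ∈ 𝓝 (0 : UnitAddCircle) :=
    (hV.preimage (continuous_const_add _)).mem_nhds (by simpa using hm)
  have hfwd : ∀ᶠ n in atTop, c ≤ f ((rotation α ^ (m + q n : ℤ)) x) := by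
    filter_upwards [hqα hV0] with n hn
    apply hVc
    rw [rotation_zpow_apply, add_zsmul, natCast_zsmul, ← add_assoc]
    exact hn
  have hbwd : ∀ᶠ n in atTop, c ≤ f ((rotation α ^ (m - q n : ℤ)) x) := by
    have hqα' : Tendsto (fun n => -(q n • (α : UnitAddCircle))) atTop (𝓝 0) := by
      simpa using hqα.neg
    filter_upwards [hqα' hV0] with n hn
    apply hVc
    rw [rotation_zpow_apply, sub_zsmul, natCast_zsmul, ← add_assoc x]
    exact hn
  have hup : Tendsto (fun n : ℕ => cocycle (rotation α) f (m + n) x) atTop atTop := by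
    refine tendsto_atTop_of_frequently_increment (fun i j hij => hmono.monotone (by simpa)) hc ?_
    refine hq.tendsto_atTop.frequently (hfwd.mono fun n hn => ?_).frequently
    have := cocycle_succ (rotation α) f (m + q n) x
    push_cast
    rw [← add_assoc]
    linarith
  -- The offset `m + 1` makes the increment at index `q n` equal to `f` at time `m - q n`.
  have hdown : Tendsto (fun n : ℕ => -cocycle (rotation α) f (m + 1 - n) x) atTop atTop := by
    refine tendsto_atTop_of_frequently_increment
      (fun i j hij => neg_le_neg (hmono.monotone (by omega))) hc ?_
    refine hq.tendsto_atTop.frequently (hbwd.mono fun n hn => ?_).frequently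
    have := cocycle_succ (rotation α) f (m - q n) x
    push_cast
    rw [show m + 1 - ((q n : ℤ) + 1) = m - q n by ring,
      show m + 1 - (q n : ℤ) = m - q n + 1 by ring]
    linarith
  obtain ⟨i, hi⟩ := (hup.eventually_gt_atTop r).exists
  obtain ⟨j, hj⟩ := (hdown.eventually_ge_atTop (-r)).exists
  obtain ⟨n, hn, hmax⟩ := Int.exists_greatest_of_bdd
    (P := fun n => cocycle (rotation α) f n x ≤ r)
    ⟨m + i, fun z hz => by
      by_contra hlt
      exact (hi.trans (hmono (not_le.1 hlt))).not_ge hz⟩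
    ⟨m + 1 - j, by linarith⟩
  refine ⟨n, ⟨hn, ?_⟩, fun k hk => ?_⟩
  · by_contra hcon
    have := hmax (n + 1) (not_lt.1 hcon)
    omega
  · refine le_antisymm (hmax k hk.1) ?_
    have : n < k + 1 := hmono.lt_iff_lt.1 (hn.trans_lt hk.2)
    omega

end Roof

/-! ### Strong continuity of the Koopman representation -/

section Koopman

variable {Y : Type*} [MeasurableSpace Y] {μ : Measure Y} {S : ℝ → Y → Y}

/-- The Koopman representation of a measure-preserving flow on `L²`. -/
def koopman (h : IsMeasurePreservingFlow S μ) (t : ℝ) : Lp ℝ 2 μ →ₗᵢ[ℝ] Lp ℝ 2 μ :=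
  Lp.compMeasurePreservingₗᵢ ℝ (S t) (h.measurePreserving t)

theorem coeFn_koopman (h : IsMeasurePreservingFlow S μ) (t : ℝ) (v : Lp ℝ 2 μ) :
    koopman h t v =ᵐ[μ] fun y => v (S t y) :=
  Lp.coeFn_compMeasurePreserving _ _

/-- By invariance the quantity may be averaged over `t ∈ [0, 1]`. On each orbit it is then
controlled by continuity of translation in `L¹(ℝ)`, and dominated convergence integrates over
orbits. -/
theorem tendsto_measure_symmDiff_flow (h : IsMeasurePreservingFlow S μ) {A : Set Y}
    (hA : MeasurableSet A) : Tendsto (fun s => μ (symmDiff (S s ⁻¹' A) A)) (𝓝 0) (𝓝 0) := by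
  have := h.isProbabilityMeasure
  set χ : Y → ℝ := A.indicator 1
  have hχm : Measurable χ := measurable_one.indicator hA
  have hχ1 (y : Y) (z : Y) : ‖χ y - χ z‖ₑ ≤ 1 := by
    by_cases h1 : y ∈ A <;> by_cases h2 : z ∈ A <;> simp [χ, h1, h2]
  have hS (t : ℝ) : Measurable (S t) := (h.measurePreserving t).measurable
  have e1 (s : ℝ) : μ (symmDiff (S s ⁻¹' A) A) = ∫⁻ y, ‖χ (S s y) - χ y‖ₑ ∂μ := by
    rw [← lintegral_indicator_one ((hS s hA).symmDiff hA)]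
    refine lintegral_congr fun y => ?_
    by_cases h1 : S s y ∈ A <;> by_cases h2 : y ∈ A <;> simp [χ, h1, h2, mem_symmDiff]
  have hm (s : ℝ) : Measurable fun q : ℝ × Y => ‖χ (S (q.1 + s) q.2) - χ (S q.1 q.2)‖ₑ := by
    refine Measurable.enorm (Measurable.sub (hχm.comp ?_) (hχm.comp h.measurable))
    exact h.measurable.comp ((measurable_fst.add_const s).prodMk measurable_snd)
  have e2 (s : ℝ) : μ (symmDiff (S s ⁻¹' A) A) =
      ∫⁻ y, (∫⁻ t in Icc (0 : ℝ) 1, ‖χ (S (t + s) y) - χ (S t y)‖ₑ) ∂μ := by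
    rw [← lintegral_lintegral_swap (hm s).aemeasurable]
    have (t : ℝ) : ∫⁻ y, ‖χ (S (t + s) y) - χ (S t y)‖ₑ ∂μ = μ (symmDiff (S s ⁻¹' A) A) := by
      have hsm : Measurable fun y => ‖χ (S s y) - χ y‖ₑ := ((hχm.comp (hS s)).sub hχm).enorm
      rw [e1, ← (h.measurePreserving t).lintegral_comp hsm]
      simp_rw [add_comm t s, h.map_add]
    simp [this]
  simp_rw [e2]
  have hz : (0 : ENNReal) = ∫⁻ _ : Y, 0 ∂μ := by simp
  rw [hz]
  refine tendsto_lintegral_filter_of_dominated_convergence (fun _ => 1)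
    (Eventually.of_forall fun s => ?_) (Eventually.of_forall fun s => ae_of_all _ fun y => ?_)
    (by simp) (ae_of_all _ fun y => ?_)
  · exact (hm s).lintegral_prod_left'
  · refine (lintegral_mono fun t => hχ1 _ _).trans ?_
    simp
  -- The window `[-1, 2]` has finite length and contains both `t` and `t + s` for `t ∈ [0, 1]` and
  -- `|s| < 1`.
  · set E : Set ℝ := {t | S t y ∈ A} ∩ Icc (-1) 2
    have hEm : MeasurableSet E := by
      refine MeasurableSet.inter ?_ measurableSet_Icc
      exact (h.measurable.comp measurable_prodMk_right) hA
    have hmem : MemLp (E.indicator (1 : ℝ → ℝ)) 1 := by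
      refine memLp_indicator_const 1 hEm 1 (Or.inr ?_)
      exact ((measure_mono inter_subset_right).trans_lt measure_Icc_lt_top).ne
    refine tendsto_of_tendsto_of_tendsto_of_le_of_le' tendsto_const_nhds
      (tendsto_lintegral_translate hmem) (Eventually.of_forall fun _ => zero_le) ?_
    filter_upwards [Metric.ball_mem_nhds (0 : ℝ) one_pos] with s hs
    rw [Metric.mem_ball, dist_zero_right, Real.norm_eq_abs, abs_lt] at hs
    refine le_trans (le_of_eq ?_) (setLIntegral_le_lintegral (Icc (0 : ℝ) 1) _)
    refine setLIntegral_congr_fun measurableSet_Icc fun t ht => ?_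
    have h1 : t ∈ Icc (-1 : ℝ) 2 := ⟨by linarith [ht.1], by linarith [ht.2]⟩
    have h2 : t + s ∈ Icc (-1 : ℝ) 2 := ⟨by linarith [ht.1], by linarith [ht.2]⟩
    have e {r : ℝ} (hr : r ∈ Icc (-1 : ℝ) 2) : E.indicator (1 : ℝ → ℝ) r = χ (S r y) := by
      by_cases hr' : S r y ∈ A <;> simp [E, χ, indicator, hr', hr.1, hr.2]
    simp only [e h1, e h2]

theorem isIsometricAction_koopman (h : IsMeasurePreservingFlow S μ) :
    IsIsometricAction (koopman h) := by
  have := h.isProbabilityMeasure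
  have hzero (v : Lp ℝ 2 μ) : koopman h 0 v = v := by
    apply Lp.ext
    filter_upwards [coeFn_koopman h 0 v] with y hy
    rw [hy, h.map_zero]
  have hadd (s t : ℝ) (v : Lp ℝ 2 μ) : koopman h (s + t) v = koopman h s (koopman h t v) := by
    apply Lp.ext
    filter_upwards [coeFn_koopman h (s + t) v, coeFn_koopman h s (koopman h t v),
      (h.measurePreserving s).quasiMeasurePreserving.ae (coeFn_koopman h t v)] with y h1 h2 h3
    rw [h1, h2, h3, add_comm s t, h.map_add]
  have hlim (v : Lp ℝ 2 μ) : Tendsto (fun t => koopman h t v) (𝓝 0) (𝓝 v) := by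
    refine Lp.induction (by simp) (motive := fun v : Lp ℝ 2 μ =>
      Tendsto (fun t => koopman h t v) (𝓝 0) (𝓝 v)) ?_ ?_ ?_ v
    · intro c A hA hμA
      rw [Lp.simpleFunc.coe_indicatorConst]
      have e (t : ℝ) : koopman h t (indicatorConstLp 2 hA hμA.ne c) =
          indicatorConstLp 2 ((h.measurePreserving t).measurable hA) (measure_ne_top _ _) c := rfl
      simp_rw [e]
      exact tendsto_indicatorConstLp_set (by simp) (tendsto_measure_symmDiff_flow h hA)
    · intro v w hv hw _ h1 h2
      simpa only [map_add] using h1.add h2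
    · refine isClosed_of_closure_subset fun v hv => ?_
      rw [mem_ofPred_eq, Metric.tendsto_nhds]
      intro ε hε
      obtain ⟨w, hw, hvw⟩ := Metric.mem_closure_iff.1 hv (ε / 3) (by positivity)
      filter_upwards [Metric.tendsto_nhds.1 hw (ε / 3) (by positivity)] with t ht
      have h1 : dist (koopman h t v) (koopman h t w) = dist v w :=
        (koopman h t).isometry.dist_eq v w
      have h2 := dist_triangle4 (koopman h t v) (koopman h t w) w v
      rw [h1, dist_comm w v] at h2
      linarith
  refine ⟨hzero, hadd, fun v => continuous_iff_continuousAt.2 fun t => ?_⟩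
  have h1 : Tendsto (fun s => koopman h t (koopman h (s - t) v)) (𝓝 t) (𝓝 (koopman h t v)) := by
    refine ((koopman h t).continuous.tendsto v).comp ((hlim v).comp ?_)
    exact Continuous.tendsto' (by fun_prop) _ _ (sub_self t)
  refine h1.congr fun s => ?_
  rw [← hadd, add_sub_cancel]

end Koopman

/-! ### Double ergodicity implies weak mixing -/

section Mixing

variable {Y : Type*} [MeasurableSpace Y] {μ : Measure Y} {S : ℝ → Y → Y}

/-- The Koopman representation of the diagonal flow on `L²(Y × Y) = L²(Y, L²(Y))`. -/
def diagKoopman (h : IsMeasurePreservingFlow S μ) (t : ℝ) :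
    Lp (Lp ℝ 2 μ) 2 μ →L[ℝ] Lp (Lp ℝ 2 μ) 2 μ :=
  ((koopman h t).toContinuousLinearMap.compLpL 2 μ).comp
    (Lp.compMeasurePreservingₗᵢ ℝ (S t) (h.measurePreserving t)).toContinuousLinearMap

theorem coeFn_diagKoopman (h : IsMeasurePreservingFlow S μ) (t : ℝ) (G : Lp (Lp ℝ 2 μ) 2 μ) :
    diagKoopman h t G =ᵐ[μ] fun y => koopman h t (G (S t y)) := by
  have h1 := ContinuousLinearMap.coeFn_compLpL (p := 2) (μ := μ)
    (koopman h t).toContinuousLinearMap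
    (Lp.compMeasurePreservingₗᵢ ℝ (S t) (h.measurePreserving t) G)
  have h2 : Lp.compMeasurePreservingₗᵢ ℝ (S t) (h.measurePreserving t) G =ᵐ[μ] G ∘ S t :=
    Lp.coeFn_compMeasurePreserving _ _
  filter_upwards [h1, h2] with y hy1 hy2
  exact hy1.trans (congrArg (koopman h t) hy2)

theorem norm_diagKoopman_le (h : IsMeasurePreservingFlow S μ) (t : ℝ) (G : Lp (Lp ℝ 2 μ) 2 μ) :
    ‖diagKoopman h t G‖ ≤ ‖G‖ := by
  refine (ContinuousLinearMap.norm_compLp_le _ _).trans ?_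
  refine (mul_le_of_le_one_left (norm_nonneg _)
    (LinearIsometry.norm_toContinuousLinearMap_le _)).trans_eq ?_
  exact LinearIsometry.norm_map _ _

theorem diagKoopman_add (h : IsMeasurePreservingFlow S μ) (s t : ℝ) (G : Lp (Lp ℝ 2 μ) 2 μ) :
    diagKoopman h (s + t) G = diagKoopman h s (diagKoopman h t G) := by
  apply Lp.ext
  filter_upwards [coeFn_diagKoopman h (s + t) G, coeFn_diagKoopman h s (diagKoopman h t G),
    (h.measurePreserving s).quasiMeasurePreserving.ae (coeFn_diagKoopman h t G)] with y h1 h2 h3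
  rw [h1, h2, h3, (isIsometricAction_koopman h).map_add, add_comm s t, h.map_add]

/-- The function `v ⊗ w` on `Y × Y`. -/
def tensor (v w : Lp ℝ 2 μ) : Lp (Lp ℝ 2 μ) 2 μ :=
  (ContinuousLinearMap.toSpanSingleton ℝ w).compLp v

theorem coeFn_tensor (v w : Lp ℝ 2 μ) : tensor v w =ᵐ[μ] fun y => v y • w := by
  filter_upwards [(ContinuousLinearMap.toSpanSingleton ℝ w).coeFn_compLp v] with y hy
  rw [tensor, hy, ContinuousLinearMap.toSpanSingleton_apply]

/-- Squared correlations are matrix coefficients of the diagonal flow, so their averages fall under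
a mean ergodic argument. -/
theorem inner_tensor_diagKoopman (h : IsMeasurePreservingFlow S μ) (t : ℝ) (v w : Lp ℝ 2 μ) :
    inner ℝ (tensor v v) (diagKoopman h t (tensor w w)) = inner ℝ v (koopman h t w) ^ 2 := by
  rw [L2.inner_def]
  have e : inner ℝ v (koopman h t w) = ∫ y, v y * w (S t y) ∂μ := by
    rw [L2.inner_def]
    refine integral_congr_ae ?_
    filter_upwards [coeFn_koopman h t w] with y hy
    rw [hy]; simp [mul_comm]
  have e2 : ∫ y, inner ℝ (tensor v v y) (diagKoopman h t (tensor w w) y) ∂μ =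
      ∫ y, (v y * w (S t y)) * inner ℝ v (koopman h t w) ∂μ := by
    refine integral_congr_ae ?_
    filter_upwards [coeFn_tensor v v, coeFn_diagKoopman h t (tensor w w),
      (h.measurePreserving t).quasiMeasurePreserving.ae (coeFn_tensor w w)] with y h1 h2 h3
    rw [h1, h2, h3, map_smul, real_inner_smul_left, real_inner_smul_right, mul_assoc]
  rw [e2, integral_mul_const, ← e, sq]

theorem stronglyMeasurable_inner_diagKoopman (h : IsMeasurePreservingFlow S μ)
    (V G : Lp (Lp ℝ 2 μ) 2 μ) :
    StronglyMeasurable fun t => inner ℝ V (diagKoopman h t G) := by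
  have := h.isProbabilityMeasure
  have e (t : ℝ) : inner ℝ V (diagKoopman h t G) =
      ∫ y, inner ℝ (V y) (koopman h t (G (S t y))) ∂μ := by
    rw [L2.inner_def]
    refine integral_congr_ae ?_
    filter_upwards [coeFn_diagKoopman h t G] with y hy
    rw [hy]
  simp_rw [e]
  have hG : StronglyMeasurable fun q : ℝ × Y => koopman h q.1 (G (S q.1 q.2)) :=
    (isIsometricAction_koopman h).continuous_uncurry.comp_stronglyMeasurable
      (measurable_fst.stronglyMeasurable.prodMk
        ((Lp.stronglyMeasurable G).comp_measurable h.measurable))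
  have hV : StronglyMeasurable fun q : ℝ × Y => V q.2 :=
    (Lp.stronglyMeasurable V).comp_measurable measurable_snd
  exact (hV.inner hG).integral_prod_right

theorem intervalIntegrable_inner_diagKoopman (h : IsMeasurePreservingFlow S μ)
    (V G : Lp (Lp ℝ 2 μ) 2 μ) (a b : ℝ) :
    IntervalIntegrable (fun t => inner ℝ V (diagKoopman h t G)) volume a b := by
  refine (intervalIntegrable_const (c := ‖V‖ * ‖G‖)).mono_fun
    (stronglyMeasurable_inner_diagKoopman h V G).aestronglyMeasurable (ae_of_all _ fun t => ?_)
  refine (norm_inner_le_norm _ _).trans (le_trans ?_ (le_abs_self _))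
  gcongr
  exact norm_diagKoopman_le h t G

theorem norm_average_le {a : ℝ → ℝ} {C : ℝ} (ha : ∀ t, |a t| ≤ C) {τ : ℝ} (hτ : 0 < τ) :
    |(1 / τ) * ∫ t in (0 : ℝ)..τ, a t| ≤ C := by
  have h1 := intervalIntegral.norm_integral_le_of_norm_le_const (a := 0) (b := τ) (C := C)
    (f := a) fun t _ => ha t
  rw [sub_zero, abs_of_pos hτ, Real.norm_eq_abs] at h1
  rw [abs_mul, abs_of_pos (by positivity : 0 < 1 / τ), one_div, inv_mul_le_iff₀ hτ]
  linarith

/-- Functions orthogonal to all invariant functions have vanishing averages. -/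
theorem tendsto_average_of_orthogonal (h : IsMeasurePreservingFlow S μ)
    (V G : Lp (Lp ℝ 2 μ) 2 μ)
    (hG : ∀ F : Lp (Lp ℝ 2 μ) 2 μ, (∀ t, diagKoopman h t F = F) → inner ℝ F G = 0) :
    Tendsto (fun τ : ℝ => (1 / τ) * ∫ t in (0 : ℝ)..τ, inner ℝ V (diagKoopman h t G)) atTop
      (𝓝 0) := by
  set K : Submodule ℝ (Lp (Lp ℝ 2 μ) 2 μ) := Submodule.span ℝ
    {x | ∃ s F, x = diagKoopman h s F - F}
  have hGK : G ∈ K.topologicalClosure := by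
    -- A vector orthogonal to all coboundaries is invariant: `⟪U_t F, F⟫ = ‖F‖²` and `‖U_t F‖ ≤ ‖F‖`
    -- force `U_t F = F`. Hence `G` is a limit of combinations of coboundaries.
    rw [← Submodule.orthogonal_orthogonal_eq_closure, Submodule.mem_orthogonal]
    intro F hF
    refine hG F fun t => ?_
    rw [Submodule.mem_orthogonal] at hF
    have h1 := hF _ (Submodule.subset_span ⟨t, F, rfl⟩)
    have h2 : ‖diagKoopman h t F - F‖ ^ 2 ≤ 0 := by
      rw [inner_sub_left, real_inner_self_eq_norm_sq] at h1
      rw [norm_sub_sq_real]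
      have := norm_diagKoopman_le h t F
      have : ‖diagKoopman h t F‖ ^ 2 ≤ ‖F‖ ^ 2 := by gcongr
      linarith
    have h3 : ‖diagKoopman h t F - F‖ = 0 := by
      nlinarith [norm_nonneg (diagKoopman h t F - F)]
    exact sub_eq_zero.1 (norm_eq_zero.1 h3)
  have hint := intervalIntegrable_inner_diagKoopman h V
  have hb (F : Lp (Lp ℝ 2 μ) 2 μ) (t : ℝ) : |inner ℝ V (diagKoopman h t F)| ≤ ‖V‖ * ‖F‖ := by
    refine (abs_real_inner_le_norm _ _).trans ?_
    gcongr
    exact norm_diagKoopman_le h t F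
  have hspan : ∀ F ∈ K, Tendsto
      (fun τ : ℝ => (1 / τ) * ∫ t in (0 : ℝ)..τ, inner ℝ V (diagKoopman h t F)) atTop (𝓝 0) := by
    intro F hF
    induction hF using Submodule.span_induction with
    | mem x hx =>
      obtain ⟨s, F, rfl⟩ := hx
      -- For a coboundary the integral telescopes to two integrals over intervals of length `|s|`,
      -- bounded independently of `τ`.
      have e (τ : ℝ) : ∫ t in (0 : ℝ)..τ, inner ℝ V (diagKoopman h t (diagKoopman h s F - F)) =
          (∫ t in τ..τ + s, inner ℝ V (diagKoopman h t F)) -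
            ∫ t in (0 : ℝ)..s, inner ℝ V (diagKoopman h t F) := by
        simp_rw [map_sub, inner_sub_right, ← diagKoopman_add]
        rw [intervalIntegral.integral_sub _ (hint _ _ _),
          intervalIntegral.integral_comp_add_right
            (fun t => inner ℝ V (diagKoopman h t F)) s, zero_add]
        · have h1 := intervalIntegral.integral_add_adjacent_intervals (hint F s τ)
            (hint F τ (τ + s))
          have h2 := intervalIntegral.integral_add_adjacent_intervals (hint F 0 s) (hint F s τ)
          linarith
        · simp_rw [diagKoopman_add]
          exact hint _ _ _
      have hbound (a b : ℝ) : |∫ t in a..b, inner ℝ V (diagKoopman h t F)| ≤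
          ‖V‖ * ‖F‖ * |b - a| := by
        rw [← Real.norm_eq_abs]
        exact intervalIntegral.norm_integral_le_of_norm_le_const fun t _ => hb F t
      have hz : Tendsto (fun τ : ℝ => (1 / τ) * (2 * (‖V‖ * ‖F‖ * |s|))) atTop (𝓝 0) := by
        simpa using (tendsto_inv_atTop_zero (𝕜 := ℝ)).mul_const (2 * (‖V‖ * ‖F‖ * |s|))
      refine squeeze_zero_norm' ?_ hz
      filter_upwards [eventually_gt_atTop 0] with τ hτ
      rw [e, norm_mul, Real.norm_of_nonneg (by positivity : 0 ≤ 1 / τ)]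
      gcongr
      refine (abs_sub _ _).trans ?_
      have h1 := hbound τ (τ + s)
      have h2 := hbound 0 s
      rw [add_sub_cancel_left] at h1
      rw [sub_zero] at h2
      linarith
    | zero => simp
    | add x y _ _ hx hy =>
      have e (τ : ℝ) : (1 / τ) * ∫ t in (0 : ℝ)..τ, inner ℝ V (diagKoopman h t (x + y)) =
          (1 / τ) * (∫ t in (0 : ℝ)..τ, inner ℝ V (diagKoopman h t x)) +
            (1 / τ) * ∫ t in (0 : ℝ)..τ, inner ℝ V (diagKoopman h t y) := by
        simp_rw [map_add, inner_add_right]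
        rw [intervalIntegral.integral_add (hint _ _ _) (hint _ _ _), mul_add]
      simp_rw [e]
      simpa using hx.add hy
    | smul c x _ hx =>
      have e (τ : ℝ) : (1 / τ) * ∫ t in (0 : ℝ)..τ, inner ℝ V (diagKoopman h t (c • x)) =
          c * ((1 / τ) * ∫ t in (0 : ℝ)..τ, inner ℝ V (diagKoopman h t x)) := by
        simp_rw [map_smul, real_inner_smul_right]
        rw [intervalIntegral.integral_const_mul]; ring
      simp_rw [e]
      simpa using hx.const_mul c
  rw [Metric.tendsto_nhds]
  intro ε hε
  have hδ : 0 < ε / (2 * (‖V‖ + 1)) := by positivity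
  obtain ⟨F, hFK, hF⟩ := Metric.mem_closure_iff.1 hGK _ hδ
  filter_upwards [Metric.tendsto_nhds.1 (hspan F hFK) (ε / 2) (half_pos hε),
    eventually_gt_atTop 0] with τ hτ hτ0
  rw [dist_zero_right, Real.norm_eq_abs] at hτ ⊢
  have e : (1 / τ) * ∫ t in (0 : ℝ)..τ, inner ℝ V (diagKoopman h t G) =
      (1 / τ) * (∫ t in (0 : ℝ)..τ, inner ℝ V (diagKoopman h t F)) +
        (1 / τ) * ∫ t in (0 : ℝ)..τ, inner ℝ V (diagKoopman h t (G - F)) := by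
    rw [← mul_add, ← intervalIntegral.integral_add (hint _ _ _) (hint _ _ _)]
    simp_rw [← inner_add_right, ← map_add, add_sub_cancel]
  have h2 := norm_average_le (hb (G - F)) hτ0
  rw [dist_eq_norm] at hF
  have h3 : ‖V‖ * ‖G - F‖ ≤ ε / 2 := by
    calc ‖V‖ * ‖G - F‖ ≤ (‖V‖ + 1) * (ε / (2 * (‖V‖ + 1))) := by
          gcongr; linarith
      _ = ε / 2 := by field_simp
  rw [e]
  refine (abs_add_le _ _).trans_lt ?_
  linarith

theorem tendsto_average_abs_of_sq {c : ℝ → ℝ} (hc : Continuous c)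
    (h : Tendsto (fun τ : ℝ => (1 / τ) * ∫ t in (0 : ℝ)..τ, c t ^ 2) atTop (𝓝 0)) :
    Tendsto (fun τ : ℝ => (1 / τ) * ∫ t in (0 : ℝ)..τ, |c t|) atTop (𝓝 0) := by
  rw [Metric.tendsto_nhds]
  intro ε hε
  filter_upwards [Metric.tendsto_nhds.1 h ((ε / 2) ^ 2) (by positivity), eventually_gt_atTop 0]
    with τ hτ hτ0
  rw [dist_zero_right, Real.norm_eq_abs] at hτ ⊢
  have hnn : 0 ≤ (1 / τ) * ∫ t in (0 : ℝ)..τ, |c t| :=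
    mul_nonneg (by positivity)
      (intervalIntegral.integral_nonneg hτ0.le fun t _ => abs_nonneg _)
  rw [abs_of_nonneg hnn]
  have hpt (t : ℝ) : |c t| ≤ ε / 2 + (ε / 2)⁻¹ * c t ^ 2 := by
    have h1 : 0 ≤ (ε / 2)⁻¹ * (|c t| - ε / 2) ^ 2 := by positivity
    have h2 : (ε / 2)⁻¹ * (|c t| - ε / 2) ^ 2 =
        (ε / 2)⁻¹ * c t ^ 2 - 2 * |c t| + ε / 2 := by
      rw [sub_sq, sq_abs]; field_simp
    have := abs_nonneg (c t)
    linarith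
  have hmono : ∫ t in (0 : ℝ)..τ, |c t| ≤
      ∫ t in (0 : ℝ)..τ, (ε / 2 + (ε / 2)⁻¹ * c t ^ 2) :=
    intervalIntegral.integral_mono_on hτ0.le (hc.abs.intervalIntegrable _ _)
      (Continuous.intervalIntegrable (by fun_prop) _ _) fun t _ => hpt t
  rw [intervalIntegral.integral_add (by simp) (Continuous.intervalIntegrable (by fun_prop) _ _),
    intervalIntegral.integral_const, intervalIntegral.integral_const_mul, sub_zero,
    smul_eq_mul] at hmono
  calc (1 / τ) * ∫ t in (0 : ℝ)..τ, |c t|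
      ≤ (1 / τ) * (τ * (ε / 2) + (ε / 2)⁻¹ * ∫ t in (0 : ℝ)..τ, c t ^ 2) := by gcongr
    _ = ε / 2 + (ε / 2)⁻¹ * ((1 / τ) * ∫ t in (0 : ℝ)..τ, c t ^ 2) := by field_simp
    _ < ε / 2 + (ε / 2)⁻¹ * (ε / 2) ^ 2 := by
        gcongr
        exact (le_abs_self _).trans_lt hτ
    _ = ε := by field_simp; ring

/-- The double ergodicity criterion for weak mixing. -/
theorem isWeaklyMixing_of_invariant (h : IsMeasurePreservingFlow S μ)
    (hconst : ∀ v : Lp ℝ 2 μ, (∀ t, koopman h t v = v) → ∃ c, v =ᵐ[μ] fun _ => c)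
    (hprod : ∀ F : Y → Lp ℝ 2 μ, StronglyMeasurable F →
      (∀ t, ∀ᵐ y ∂μ, koopman h t (F (S t y)) = F y) →
      ∃ v, (∀ t, koopman h t v = v) ∧ ∀ᵐ y ∂μ, F y = v) : IsWeaklyMixing S μ := by
  have := h.isProbabilityMeasure
  refine ⟨h, fun A hA hinv => ?_, fun A B hA hB => ?_⟩
  · obtain ⟨c, hc⟩ := hconst (indicatorConstLp 2 hA (measure_ne_top μ A) 1) fun t => by
      apply Lp.ext
      filter_upwards [coeFn_koopman h t (indicatorConstLp 2 hA (measure_ne_top μ A) (1 : ℝ)),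
        (h.measurePreserving t).quasiMeasurePreserving.ae (indicatorConstLp_coeFn (p := 2)
          (hs := hA) (hμs := measure_ne_top μ A) (c := (1 : ℝ))),
        indicatorConstLp_coeFn (p := 2) (hs := hA) (hμs := measure_ne_top μ A) (c := (1 : ℝ)),
        hinv t] with y h1 h2 h3 h4
      rw [h1, h2, h3]
      have h5 : S t y ∈ A ↔ y ∈ A := iff_of_eq h4
      by_cases hy : y ∈ A
      · simp [hy, h5.2 hy]
      · simp [hy, mt h5.1 hy]
    have hA1 : ∀ᵐ y ∂μ, A.indicator (fun _ => (1 : ℝ)) y = c := by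
      filter_upwards [hc, indicatorConstLp_coeFn (p := 2) (hs := hA)
        (hμs := measure_ne_top μ A) (c := (1 : ℝ))] with y h1 h2
      rw [← h2, h1]
    by_cases hc1 : c = 1
    · right
      rw [prob_compl_eq_zero_iff hA |>.symm, ← mem_ae_iff]
      filter_upwards [hA1] with y hy
      by_contra hyA
      rw [indicator_of_notMem hyA, hc1] at hy
      exact zero_ne_one hy
    · left
      rw [measure_eq_zero_iff_ae_notMem]
      filter_upwards [hA1] with y hy hyA
      rw [indicator_of_mem hyA] at hy
      exact hc1 hy.symm
  · have hmem (A : Set Y) (hA : MeasurableSet A) :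
        MemLp (fun y => A.indicator (fun _ => (1 : ℝ)) y - μ.real A) 2 μ :=
      (memLp_indicator_const 2 hA 1 (Or.inr (measure_ne_top μ A))).sub (memLp_const _)
    set v : Lp ℝ 2 μ := (hmem A hA).toLp
    set w : Lp ℝ 2 μ := (hmem B hB).toLp
    have hind (C : Set Y) (hC : MeasurableSet C) :
        Integrable (C.indicator fun _ => (1 : ℝ)) μ := (integrable_const 1).indicator hC
    have hintC (C : Set Y) (hC : MeasurableSet C) :
        ∫ y, C.indicator (fun _ => (1 : ℝ)) y ∂μ = μ.real C := integral_indicator_one hC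
    have hw0 : ∫ y, w y ∂μ = 0 := by
      rw [integral_congr_ae (hmem B hB).coeFn_toLp, integral_sub (hind B hB)
        (integrable_const _), hintC B hB]
      simp
    -- Centring both indicator functions absorbs the product `μ(A) μ(B)` into the inner product.
    have hcorr (t : ℝ) : μ.real (S t '' A ∩ B) - μ.real A * μ.real B =
        inner ℝ v (koopman h t w) := by
      have hSt := (h.measurePreserving t).measurable
      have himg : S t '' A = S (-t) ⁻¹' A := by
        ext y; constructor
        · rintro ⟨x, hx, rfl⟩
          rwa [mem_preimage, ← h.map_add, neg_add_cancel, h.map_zero]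
        · intro hy
          exact ⟨_, hy, by rw [← h.map_add, add_neg_cancel, h.map_zero]⟩
      have hinj : Function.Injective (S t) := fun x y hxy => by
        have := congrArg (S (-t)) hxy
        rwa [← h.map_add, ← h.map_add, neg_add_cancel, h.map_zero, h.map_zero] at this
      have hmeas : MeasurableSet (S t '' A ∩ B) := by
        rw [himg]; exact ((h.measurePreserving (-t)).measurable hA).inter hB
      have e1 : μ.real (S t '' A ∩ B) = μ.real (A ∩ S t ⁻¹' B) := by
        rw [measureReal_def, ← (h.measurePreserving t).measure_preimage hmeas.nullMeasurableSet,
          preimage_inter, preimage_image_eq _ hinj, measureReal_def]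
      have e2 : inner ℝ v (koopman h t w) =
          ∫ y, (((A ∩ S t ⁻¹' B).indicator (fun _ => (1 : ℝ)) y -
            μ.real B * A.indicator (fun _ => (1 : ℝ)) y) -
            (μ.real A * (S t ⁻¹' B).indicator (fun _ => (1 : ℝ)) y - μ.real A * μ.real B)) ∂μ := by
        rw [L2.inner_def]
        refine integral_congr_ae ?_
        filter_upwards [(hmem A hA).coeFn_toLp, coeFn_koopman h t w,
          (h.measurePreserving t).quasiMeasurePreserving.ae (hmem B hB).coeFn_toLp] with y h1 h2 h3
        rw [h1, h2, h3]
        by_cases hyA : y ∈ A <;> by_cases hyB : S t y ∈ B <;>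
          simp [indicator, hyA, hyB] <;> ring
      have hAB := hA.inter (hSt hB)
      have i1 : Integrable (fun y => (A ∩ S t ⁻¹' B).indicator (fun _ => (1 : ℝ)) y -
          μ.real B * A.indicator (fun _ => (1 : ℝ)) y) μ :=
        (hind _ hAB).sub ((hind A hA).const_mul _)
      have i2 : Integrable (fun y => μ.real A * (S t ⁻¹' B).indicator (fun _ => (1 : ℝ)) y -
          μ.real A * μ.real B) μ := ((hind _ (hSt hB)).const_mul _).sub (integrable_const _)
      rw [e2, integral_sub i1 i2,
        integral_sub (hind _ hAB) ((hind A hA).const_mul _),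
        integral_sub ((hind _ (hSt hB)).const_mul _) (integrable_const _),
        integral_const_mul, integral_const_mul, hintC _ hAB, hintC A hA, hintC _ (hSt hB),
        e1, measureReal_def μ (S t ⁻¹' B),
        (h.measurePreserving t).measure_preimage hB.nullMeasurableSet, ← measureReal_def]
      simp
      ring
    simp_rw [hcorr]
    refine tendsto_average_abs_of_sq
      (continuous_const.inner ((isIsometricAction_koopman h).continuous w)) ?_
    simp_rw [← inner_tensor_diagKoopman]
    refine tendsto_average_of_orthogonal h _ _ fun F hF => ?_
    obtain ⟨u, hu, hFu⟩ := hprod F (Lp.stronglyMeasurable F) fun t => by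
      filter_upwards [coeFn_diagKoopman h t F] with y hy
      rw [← hy, hF]
    obtain ⟨c, hc⟩ := hconst u hu
    -- The invariant `F` has the single value `u`, a constant function, and is therefore orthogonal
    -- to `w ⊗ w` because `w` has mean zero.
    have huw : inner ℝ u w = 0 := by
      rw [L2.inner_def]
      have : ∫ y, inner ℝ (u y) (w y) ∂μ = ∫ y, c * w y ∂μ := by
        refine integral_congr_ae ?_
        filter_upwards [hc] with y hy
        rw [hy]; simp [mul_comm]
      rw [this, integral_const_mul, hw0, mul_zero]
    rw [L2.inner_def]
    refine integral_eq_zero_of_ae ?_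
    filter_upwards [hFu, coeFn_tensor w w] with y h1 h2
    rw [h1, h2, real_inner_smul_right, huw, mul_zero, Pi.zero_apply]

end Mixing

/-! ### Application to the special flow over the rotation -/

section Rotation

variable {α : ℝ} {f : UnitAddCircle → ℝ}
variable {H : Type*} [NormedAddCommGroup H] [NormedSpace ℝ H]
  {U : ℝ → H →ₗᵢ[ℝ] H}

/-- Once almost every value of `φ` is fixed by `U`, the cocycle equation reduces to invariance under
the rotation, and ergodicity applies. -/
theorem ae_eq_const_of_cocycle (hα : Irrational α) (hf : IsBVaj f) (hS : jumpSum f ≠ 0)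
    (hU : IsIsometricAction U) {φ : UnitAddCircle → H} (hφm : StronglyMeasurable φ)
    (hφ : ∀ᵐ x, φ x = U (f x) (φ (rotation α x))) :
    ∃ h, (∀ t, U t h = h) ∧ ∀ᵐ x, φ x = h := by
  have hα' := ergodic_rotation hα
  have hfix := ae_fixed_of_cocycle hα hf hS hU hφm hφ
  have hinv : φ ∘ (fun x => x + (α : UnitAddCircle)) =ᵐ[volume] φ := by
    filter_upwards [hφ, hα'.quasiMeasurePreserving.ae hfix] with x h1 h2
    rw [h1, Function.comp_apply]
    exact (h2 (f x)).symm
  obtain ⟨h, hh⟩ := hα'.ae_eq_const_of_ae_eq_comp_ae hφm.aestronglyMeasurable hinv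
  have hh' : ∀ᵐ x, φ x = h := hh
  obtain ⟨x, h1, h2⟩ := (hfix.and hh').exists
  exact ⟨h, h2 ▸ h1, hh'⟩

theorem ae_eq_const_of_equivariant_rotation (hα : Irrational α) (hpos : ∀ x, 0 < f x)
    (hf : IsBVaj f) (hS : jumpSum f ≠ 0) (hU : IsIsometricAction U)
    {F : Space f → H} (hF : StronglyMeasurable F)
    (hinv : ∀ t, ∀ᵐ y ∂probMeasure volume f, U t (F (flow (rotation α) f t y)) = F y) :
    ∃ h, (∀ t, U t h = h) ∧ ∀ᵐ y ∂probMeasure volume f, F y = h := by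
  obtain ⟨hfm, C, hC⟩ := hf.bv.exists_measurable_bounded
  have hfi : Integrable f := .of_bound hfm.aestronglyMeasurable C (ae_of_all _ hC)
  simp_rw [ae_probMeasure_iff hfm hfi] at hinv ⊢
  exact ae_eq_const_of_equivariant hpos (measurePreserving_rotation_zpow α) hfm
    (existsUnique_isPassage hα hf.leftContinuous hpos) hU hF hinv
    fun φ hφm hφ => ae_eq_const_of_cocycle hα hf hS hU hφm hφ

theorem isMeasurePreservingFlow_rotation (hα : Irrational α) (hpos : ∀ x, 0 < f x)
    (hf : IsBVaj f) :
    IsMeasurePreservingFlow (flow (rotation α) f) (probMeasure volume f) := by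
  obtain ⟨hfm, C, hC⟩ := hf.bv.exists_measurable_bounded
  exact isMeasurePreservingFlow hpos (measurePreserving_rotation_zpow α) hfm
    (.of_bound hfm.aestronglyMeasurable C (ae_of_all _ hC))
    (existsUnique_isPassage hα hf.leftContinuous hpos)

theorem isWeaklyMixing_flow_rotation (hα : Irrational α) (hpos : ∀ x, 0 < f x)
    (hf : IsBVaj f) (hS : jumpSum f ≠ 0) :
    IsWeaklyMixing (flow (rotation α) f) (probMeasure volume f) := by
  have h := isMeasurePreservingFlow_rotation hα hpos hf
  refine isWeaklyMixing_of_invariant h (fun v hv => ?_) fun F hF hinv =>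
    ae_eq_const_of_equivariant_rotation hα hpos hf hS (isIsometricAction_koopman h) hF hinv
  -- The trivial action on `ℝ` turns the equivariant statement into ergodicity of the flow itself.
  obtain ⟨c, -, hc⟩ := ae_eq_const_of_equivariant_rotation (U := fun _ => LinearIsometry.id)
    hα hpos hf hS ⟨fun _ => rfl, fun _ _ _ => rfl, fun _ => continuous_const⟩
    (Lp.stronglyMeasurable v) fun t => by
      have h1 := coeFn_koopman h t v
      rw [hv t] at h1
      filter_upwards [h1] with y hy using hy.symm
  exact ⟨c, hc⟩

end Rotation

end SpecialFlow

end

theorem mainTheorem1 (α : ℝ) (hα : Irrational α) (f : UnitAddCircle → ℝ)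
    (hpos : ∀ x, 0 < f x) (hf : SpecialFlow.IsBVaj f) (hS : SpecialFlow.jumpSum f ≠ 0) :
    (∀ (x : UnitAddCircle) (r : ℝ),
      ∃! n : ℤ, SpecialFlow.IsPassage (SpecialFlow.rotation α) f x r n) ∧
    SpecialFlow.IsWeaklyMixing (SpecialFlow.flow (SpecialFlow.rotation α) f)
      (SpecialFlow.probMeasure (volume : MeasureTheory.Measure UnitAddCircle) f) :=
  ⟨SpecialFlow.existsUnique_isPassage hα hf.leftContinuous hpos,
    SpecialFlow.isWeaklyMixing_flow_rotation hα hpos hf hS⟩
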